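/- Let $d\ge 1$ be an integer and let $1\le q<p\le\infty$. For a box $I=[a_1,b_1]\times\dots\times[a_d,b_d]\subset\mathbb R^d$ with $a_i<b_i$ for all $i$, and for $B>0$, let $\mathcal C_p(I,B)$ be the class of all convex functions $f:I\to\mathbb R$ with $\int_I|f(x)|^p\,dx\le B^p$ if $p<\infty$, and with $\sup_{x\in I}|f(x)|\le B$ if $p=\infty$. For $\epsilon>0$ let $M(\mathcal C_p(I,B),\epsilon;L_q(I))$ be the smallest number (possibly $\infty$) of closed balls of radius $\epsilon$, with respect to the pseudometric $\left(\int_I|f-g|^q\,dx\right)^{1/q}$ on the space of functions with finite $L_q(I)$ norm, whose union contains $\mathcal C_p(I,B)$. The centres of the balls need not belong to $\mathcal C_p(I,B)$. Then there exist positive constants $c_1$, $c_2$ and $\epsilon_0$, depending only on $d$, $p$ and $q$, such that for every such box $I$ and every $B>0$, with the convention $1/\infty=0$, $$\log M(\mathcal C_p(I,B),\epsilon;L_q(I))\le c_1\left(\frac{\epsilon}{B\prod_{i=1}^d(b_i-a_i)^{1/q-1/p}}\right)^{-d/2}\qquad\text{for every }\epsilon>0,$$ and $$\log M(\mathcal C_p(I,B),\epsilon;L_q(I))\ge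 c_2\left(\frac{\epsilon}{B\prod_{i=1}^d(b_i-a_i)^{1/q-1/p}}\right)^{-d/2}\qquad\text{whenever }0<\epsilon\le\epsilon_0\,B\prod_{i=1}^d(b_i-a_i)^{1/q-1/p}.$$ -/

import Mathlib

open MeasureTheory
open scoped ENNReal

noncomputable section

/-- Real functions with finite `L_q(μ)` norm, as functions (not as almost-everywhere classes). -/
def LqFun {α : Type*} [MeasurableSpace α] (q : ℝ≥0∞) (μ : Measure α) : Type _ :=
  {f : α → ℝ // MemLp f q μ}

/-- The `L_q` pseudometric `(∫ |f - g|^q dμ)^{1/q}` on `LqFun q μ`. -/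
instance LqFun.instPseudoEMetricSpace {α : Type*} [MeasurableSpace α] (q : ℝ≥0∞)
    [hq : Fact (1 ≤ q)] (μ : Measure α) : PseudoEMetricSpace (LqFun q μ) where
  edist f g := eLpNorm (fun x => f.1 x - g.1 x) q μ
  edist_self f := by
    simp only [sub_self]
    exact eLpNorm_zero
  edist_comm f g := eLpNorm_sub_comm f.1 g.1 q μ
  edist_triangle f g h := by
    have e : (fun x => f.1 x - h.1 x)
        = (fun x => f.1 x - g.1 x) + (fun x => g.1 x - h.1 x) := by
      funext x
      simp
    rw [e]
    exact eLpNorm_add_le (f.2.1.sub g.2.1) (g.2.1.sub h.2.1) hq.out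

/-- The class `C_p(I, B)` of convex functions on the box `I = ∏ i, [a i, b i]` such that
`∫_I |f|^p ≤ B^p` if `p < ∞`, and `|f| ≤ B` everywhere on `I` if `p = ∞`.
Values outside `I` are irrelevant. -/
def convexClass {d : ℕ} (p : ℝ≥0∞) (a b : Fin d → ℝ) (B : ℝ) : Set ((Fin d → ℝ) → ℝ) :=
  {f | ConvexOn ℝ (Set.Icc a b) f ∧
    if p = ∞ then ∀ x ∈ Set.Icc a b, |f x| ≤ B
    else ∫⁻ x in Set.Icc a b, ENNReal.ofReal |f x| ^ p.toReal
      ≤ ENNReal.ofReal B ^ p.toReal}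

/-- Every member of `C_p(I, B)` has finite `L_q(I)` norm for `q ≤ p`, so viewing the class inside
`LqFun` loses nothing. -/
theorem memLp_of_mem_convexClass {d : ℕ} {p q : ℝ≥0∞} (hp : p ≠ 0) (hqp : q ≤ p)
    {a b : Fin d → ℝ} {B : ℝ} {f : (Fin d → ℝ) → ℝ} (hf : f ∈ convexClass p a b B) :
    MemLp f q (volume.restrict (Set.Icc a b)) := by
  obtain ⟨hc, hb⟩ := hf
  haveI : IsFiniteMeasure (volume.restrict (Set.Icc a b)) :=
    ⟨by simpa using (isCompact_Icc (a := a) (b := b)).measure_lt_top⟩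
  have hm : AEStronglyMeasurable f (volume.restrict (Set.Icc a b)) := by
    have h1 : AEStronglyMeasurable f (volume.restrict (interior (Set.Icc a b))) :=
      hc.continuousOn_interior.aestronglyMeasurable isOpen_interior.measurableSet
    rwa [Measure.restrict_congr_set
      (interior_ae_eq_of_null_frontier ((convex_Icc a b).addHaar_frontier volume))] at h1
  have hP : MemLp f p (volume.restrict (Set.Icc a b)) := by
    by_cases ht : p = ∞
    · subst ht
      simp only [if_true] at hb
      refine memLp_top_of_bound hm B ?_
      filter_upwards [ae_restrict_mem measurableSet_Icc] with x hx using hb x hx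
    · simp only [ht, if_false] at hb
      refine ⟨hm, ?_⟩
      rw [eLpNorm_lt_top_iff_lintegral_rpow_enorm_lt_top hp ht]
      have e : ∀ x, ‖f x‖ₑ = ENNReal.ofReal |f x| := fun x => Real.enorm_eq_ofReal_abs _
      simp only [e]
      exact hb.trans_lt (ENNReal.rpow_lt_top_of_nonneg ENNReal.toReal_nonneg ENNReal.ofReal_ne_top)
  exact hP.mono_exponent hqp

/-- The metric entropy `log M(C_p(I, B), ε; L_q(I))`: the logarithm, `+∞` if there is no finite
cover, of the least number of closed `L_q(I)`-balls of radius `ε` (with centres anywhere in the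
space) that cover `C_p(I, B)`. -/
def convexEntropy {d : ℕ} (p q : ℝ≥0∞) [Fact (1 ≤ q)] (a b : Fin d → ℝ) (B ε : ℝ) : EReal :=
  ENNReal.log ((Metric.externalCoveringNumber ε.toNNReal
    {f : LqFun q (volume.restrict (Set.Icc a b)) | f.1 ∈ convexClass p a b B} : ℕ∞) : ℝ≥0∞)

/-- The scale `B ∏ i, (b i - a i)^{1/q - 1/p}`, where `1/∞ = 0`. -/
def entropyScale {d : ℕ} (p q : ℝ≥0∞) (a b : Fin d → ℝ) (B : ℝ) : ℝ :=
  B * ∏ i, (b i - a i) ^ ((q⁻¹).toReal - (p⁻¹).toReal)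

end

/-!
Rescaling reduces the theorem to the unit cube and `B = 1`.

*Upper bound.* A convex function bounded by `1` on a neighbourhood of a cube is recovered up to
`O(δ²)` from the values of its Moreau envelope on a grid of mesh `δ`, rounded to multiples of `δ²`.
The envelope is semiconcave as well as convex, so the second differences of the rounded values
along the axes take only four values, and the entropy at scale `δ²` in the supremum norm is
`O(δ ^ (-d))`. A function in `C_p([0, 1]^d, 1)` is `O(v ^ (-1 / p))` on a dyadic box of volume `v`
whose distance to the faces is comparable to its sides. Approximating it there within
`ε v ^ (-s)` with `1 / p < s < 1 / q` makes both the entropies and the `q`-th powers of the errors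
summable over all dyadic boxes.

*Lower bound.* Over a grid of `n ^ d` points, replace the paraboloid `‖x‖²` by the maximum of itself
and its slightly raised tangent planes at an arbitrary subset of the points. Each change costs
`n ^ (-2)` on its own cell, and a Chernoff bound yields `exp (c n ^ d)` subsets that pairwise differ
in a fixed proportion of the points.
-/

open RealInnerProductSpace

section Code

/-- `EntropyLE 𝓕 r H`: the members of `𝓕` can be labelled with at most `exp H` labels in such a way
that members with equal labels are related by `r`. For `r f g := edist f g ≤ ε` this bounds the
metric entropy of `𝓕` by `H`; other relations make it possible to combine local bounds. -/
def EntropyLE {X : Type*} (𝓕 : Set X) (r : X → X → Prop) (H : ℝ) : Prop :=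
  ∃ n : ℕ, (n : ℝ) ≤ Real.exp H ∧ ∃ Φ : 𝓕 → Fin n, ∀ f g : 𝓕, Φ f = Φ g → r f g

namespace EntropyLE

variable {X Y β : Type*} {𝓕 : Set X} {𝓖 : Set Y} {r : X → X → Prop} {s : Y → Y → Prop} {H H' : ℝ}

theorem of_finite [Finite β] (hβ : (Nat.card β : ℝ) ≤ Real.exp H) (Φ : 𝓕 → β)
    (hΦ : ∀ f g : 𝓕, Φ f = Φ g → r f g) : EntropyLE 𝓕 r H :=
  ⟨Nat.card β, hβ, fun f => Finite.equivFin β (Φ f), fun f g h =>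
    hΦ f g ((Finite.equivFin β).injective h)⟩

theorem of_forall (hH : 0 ≤ H) (h : ∀ f ∈ 𝓕, ∀ g ∈ 𝓕, r f g) : EntropyLE 𝓕 r H :=
  of_finite (β := Unit) (by simpa using hH) (fun _ => ()) fun f g _ => h f f.2 g g.2

theorem comap (h : EntropyLE 𝓖 s H) (hH : H ≤ H') {φ : X → Y} (hφ : Set.MapsTo φ 𝓕 𝓖)
    (hr : ∀ f ∈ 𝓕, ∀ g ∈ 𝓕, s (φ f) (φ g) → r f g) : EntropyLE 𝓕 r H' := by
  obtain ⟨n, hn, Φ, hΦ⟩ := h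
  exact ⟨n, hn.trans (Real.exp_le_exp.2 hH), fun f => Φ (hφ.restrict φ 𝓕 𝓖 f),
    fun f g hfg => hr f f.2 g g.2 (hΦ _ _ hfg)⟩

theorem mono (h : EntropyLE 𝓕 r H) (hH : H ≤ H') {r' : X → X → Prop}
    (hr : ∀ f ∈ 𝓕, ∀ g ∈ 𝓕, r f g → r' f g) : EntropyLE 𝓕 r' H' :=
  h.comap hH (Set.mapsTo_id 𝓕) hr

theorem of_lt_log_two (h : EntropyLE 𝓕 r H) (hH : H < Real.log 2) {f g : X} (hf : f ∈ 𝓕)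
    (hg : g ∈ 𝓕) : r f g := by
  obtain ⟨n, hn, Φ, hΦ⟩ := h
  have hn2 : (n : ℝ) < 2 := hn.trans_lt ((Real.lt_log_iff_exp_lt (by norm_num)).1 hH)
  have : Subsingleton (Fin n) :=
    Fin.subsingleton_iff_le_one.2 (Nat.lt_succ_iff.1 (by exact_mod_cast hn2))
  exact hΦ ⟨f, hf⟩ ⟨g, hg⟩ (Subsingleton.elim _ _)

theorem forall_mem_finset {K : Type*} {r : K → X → X → Prop} {x : K → ℝ} (F : Finset K)
    (h : ∀ k, EntropyLE 𝓕 (r k) (x k)) :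
    EntropyLE 𝓕 (fun f g => ∀ k ∈ F, r k f g) (∑ k ∈ F, x k) := by
  choose n hn Φ hΦ using h
  refine of_finite (β := (k : F) → Fin (n k)) ?_ (fun f k => Φ k f) fun f g hfg k hk =>
    hΦ k f g (congrFun hfg ⟨k, hk⟩)
  rw [Nat.card_pi, Nat.cast_prod, Real.exp_sum, ← Finset.prod_coe_sort F fun k => Real.exp (x k)]
  exact Finset.prod_le_prod (fun k _ => by positivity) fun k _ => by simpa using hn k

theorem forall_tsum {K : Type*} {r : K → X → X → Prop} {x : K → ℝ} (hx : Summable x)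
    (hx0 : ∀ k, 0 ≤ x k) (h : ∀ k, EntropyLE 𝓕 (r k) (x k)) :
    EntropyLE 𝓕 (fun f g => ∀ k, r k f g) (∑' k, x k) := by
  -- All but finitely many of the codes have at most one label.
  have hfin : {k | ¬ x k < Real.log 2}.Finite :=
    hx.tendsto_cofinite_zero.eventually_lt_const (Real.log_pos (by norm_num))
  refine (forall_mem_finset hfin.toFinset h).mono (hx.sum_le_tsum _ fun k _ => hx0 k)
    fun f hf g hg hfg k => ?_
  by_cases hk : x k < Real.log 2
  · exact (h k).of_lt_log_two hk hf hg
  · exact hfg k (hfin.mem_toFinset.2 hk)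

theorem log_externalCoveringNumber_le [PseudoEMetricSpace X] {ε : NNReal}
    (h : EntropyLE 𝓕 (fun f g => edist f g ≤ ε) H) :
    ENNReal.log ((Metric.externalCoveringNumber ε 𝓕 : ℕ∞) : ℝ≥0∞) ≤ (H : EReal) := by
  obtain ⟨n, hn, Φ, hΦ⟩ := h
  let R : Set.range Φ → X := fun t => (Set.rangeSplitting Φ t).1
  have hcov : Metric.IsCover ε 𝓕 (Set.range R) := fun f hf =>
    ⟨_, ⟨⟨Φ ⟨f, hf⟩, Set.mem_range_self _⟩, rfl⟩,
      hΦ ⟨f, hf⟩ _ (Set.apply_rangeSplitting Φ ⟨Φ ⟨f, hf⟩, Set.mem_range_self _⟩).symm⟩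
  have hcard : (Set.range R).encard ≤ n :=
    calc (Set.range R).encard ≤ ENat.card (Set.range Φ) := by
          rw [← Set.image_univ, ← Set.encard_univ]
          exact Set.encard_image_le _ _
      _ ≤ ENat.card (Fin n) := ENat.card_le_card_of_injective Subtype.val_injective
      _ = n := by simp
  have hle : ((Metric.externalCoveringNumber ε 𝓕 : ℕ∞) : ℝ≥0∞) ≤ ENNReal.ofReal (Real.exp H) :=
    calc ((Metric.externalCoveringNumber ε 𝓕 : ℕ∞) : ℝ≥0∞) ≤ ((n : ℕ∞) : ℝ≥0∞) := by
          exact_mod_cast hcov.externalCoveringNumber_le_encard.trans hcard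
      _ = ENNReal.ofReal n := by simp
      _ ≤ _ := ENNReal.ofReal_le_ofReal hn
  calc _ ≤ ENNReal.log (ENNReal.ofReal (Real.exp H)) := ENNReal.log_monotone hle
    _ = H := by rw [ENNReal.log_ofReal_of_pos (Real.exp_pos H), Real.log_exp]

end EntropyLE

end Code

section SecondDiff

variable {ι : Type*} [DecidableEq ι]

/-- The second difference of the array `k` at `m` in the direction of the `j`-th axis. -/
def secondDiff (k : (ι → ℕ) → ℤ) (j : ι) (m : ι → ℕ) : ℤ :=
  k (m + Pi.single j 2) - 2 * k (m + Pi.single j 1) + k m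

open Classical in
/-- The entries of the array `k` on `{0, 1}^ι` and, elsewhere, the second difference in one axis
direction, chosen in terms of the index only, that ends at the index. They determine `k`. -/
noncomputable def diffCode (k : (ι → ℕ) → ℤ) (m : ι → ℕ) : ℤ :=
  if h : ∃ j, 2 ≤ m j then secondDiff k h.choose (m - Pi.single h.choose 2) else k m

theorem eq_of_diffCode_eq {k k' : (ι → ℕ) → ℤ} [Finite ι] (m : ι → ℕ)
    (h : ∀ m' ≤ m, diffCode k m' = diffCode k' m') : k m = k' m := by
  induction m using WellFoundedLT.induction with
  | ind m ih =>
    have hm := h m le_rfl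
    unfold diffCode at hm
    split_ifs at hm with hex
    · set j := hex.choose
      obtain ⟨l, hl⟩ : ∃ l, m = l + Pi.single j 2 :=
        ⟨m - Pi.single j 2, (tsub_add_cancel_of_le
          (update_le_iff.2 ⟨hex.choose_spec, fun _ _ => Nat.zero_le _⟩)).symm⟩
      have ih' : ∀ l' < m, k l' = k' l' := fun l' hl' =>
        ih l' hl' fun m' hm' => h m' (hm'.trans hl'.le)
      have hl1 : l + Pi.single j 1 < m := by
        rw [hl]
        exact add_lt_add_of_le_of_lt le_rfl (update_lt_update_iff.2 one_lt_two)
      have hl0 : l < m := (le_add_of_nonneg_right (by simp)).trans_lt hl1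
      rw [hl, add_tsub_cancel_right, secondDiff, secondDiff, ← hl, ih' _ hl1, ih' _ hl0] at hm
      linarith
    · exact hm

theorem natCast_pow_le_exp_mul_log (x : ℕ) {e E : ℕ} (h : e ≤ E) :
    (x : ℝ) ^ e ≤ Real.exp (E * Real.log x) := by
  rcases x.eq_zero_or_pos with rfl | hx
  · simpa using pow_le_one₀ le_rfl zero_le_one
  · rw [Real.exp_nat_mul, Real.exp_log (by exact_mod_cast hx)]
    exact pow_le_pow_right₀ (by exact_mod_cast hx) h

theorem prod_ite_exists_two_le_le_exp [Fintype ι] (a b n : ℕ) :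
    ∏ m : ι → Fin n, (if ∃ i, 2 ≤ (m i : ℕ) then (b : ℝ) else a)
      ≤ Real.exp (2 ^ Fintype.card ι * Real.log a + n ^ Fintype.card ι * Real.log b) := by
  have hsmall : (Finset.univ.filter fun m : ι → Fin n => ¬ ∃ i, 2 ≤ (m i : ℕ)).card
      ≤ 2 ^ Fintype.card ι := by
    have hcard : (Finset.univ : Finset (ι → Fin 2)).card = 2 ^ Fintype.card ι := by simp
    rw [← hcard]
    refine Finset.card_le_card_of_injOn (fun m i => Fin.ofNat 2 (m i)) (fun _ _ => by simp)
      fun m hm m' hm' h => funext fun i => Fin.ext ?_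
    simp only [Finset.coe_filter, Set.mem_ofPred_eq, not_exists, not_le, Finset.mem_univ,
      true_and] at hm hm'
    have hmod : (m i : ℕ) % 2 = m' i % 2 := congrArg Fin.val (congrFun h i)
    rwa [Nat.mod_eq_of_lt (hm i), Nat.mod_eq_of_lt (hm' i)] at hmod
  have hlarge : (Finset.univ.filter fun m : ι → Fin n => ∃ i, 2 ≤ (m i : ℕ)).card
      ≤ n ^ Fintype.card ι := by
    simpa using Finset.card_filter_le Finset.univ fun m : ι → Fin n => ∃ i, 2 ≤ (m i : ℕ)
  rw [Finset.prod_ite, Finset.prod_const, Finset.prod_const, mul_comm, Real.exp_add]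
  exact mul_le_mul (by exact_mod_cast natCast_pow_le_exp_mul_log a hsmall)
    (by exact_mod_cast natCast_pow_le_exp_mul_log b hlarge) (by positivity) (by positivity)

theorem EntropyLE.of_secondDiff {X : Type*} {𝓕 : Set X} [Fintype ι] (k : X → (ι → ℕ) → ℤ)
    (n : ℕ) {A D : Finset ℤ} (hA : ∀ f ∈ 𝓕, ∀ m, (∀ i, m i < 2) → k f m ∈ A)
    (hD : ∀ f ∈ 𝓕, ∀ j m, secondDiff (k f) j m ∈ D) :
    EntropyLE 𝓕 (fun f g => ∀ m, (∀ i, m i < n) → k f m = k g m)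
      (2 ^ Fintype.card ι * Real.log A.card + n ^ Fintype.card ι * Real.log D.card) := by
  let S (m : ι → ℕ) : Finset ℤ := if ∃ i, 2 ≤ m i then D else A
  have hS (f : 𝓕) (m : ι → ℕ) : diffCode (k f) m ∈ S m := by
    by_cases h : ∃ i, 2 ≤ m i
    · simpa only [S, diffCode, h, if_true, dite_true] using hD f f.2 _ _
    · simp only [S, diffCode, h, if_false, dite_false]
      exact hA f f.2 m (by simpa using h)
  refine EntropyLE.of_finite (β := (m : ι → Fin n) → S fun i => m i) ?_
    (fun f m => ⟨_, hS f fun i => m i⟩) fun f g hfg m hm => eq_of_diffCode_eq m fun m' hm' =>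
      congrArg Subtype.val (congrFun hfg fun i => ⟨m' i, (hm' i).trans_lt (hm i)⟩)
  have hcard (m : ι → Fin n) : (Nat.card (S fun i => m i) : ℝ)
      = if ∃ i, 2 ≤ (m i : ℕ) then (D.card : ℝ) else A.card := by
    simp only [S, Nat.card_eq_fintype_card, Fintype.card_coe]
    split_ifs <;> rfl
  rw [Nat.card_pi, Nat.cast_prod, Finset.prod_congr rfl fun m _ => hcard m]
  exact prod_ite_exists_two_le_le_exp _ _ _

end SecondDiff

section Moreau

variable {E : Type*} [NormedAddCommGroup E] {U : Set E} {f g : E → ℝ}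

/-- The Moreau envelope `u ↦ inf_{y ∈ U} (f y + ‖y - u‖² / 2)` of `f` on `U`. For convex `f` its
second differences are bounded above and below by those of `‖·‖² / 2` and `0`. -/
noncomputable def moreauEnv (U : Set E) (f : E → ℝ) (u : E) : ℝ :=
  ⨅ y : U, f y + ‖(y : E) - u‖ ^ 2 / 2

theorem moreauEnv_le (hf : BddBelow (f '' U)) (u : E) {y : E} (hy : y ∈ U) :
    moreauEnv U f u ≤ f y + ‖y - u‖ ^ 2 / 2 := by
  obtain ⟨c, hc⟩ := hf
  refine ciInf_le (f := fun y : U => f y + ‖(y : E) - u‖ ^ 2 / 2) ⟨c, ?_⟩ ⟨y, hy⟩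
  rintro _ ⟨z, rfl⟩
  exact le_add_of_le_of_nonneg (hc (Set.mem_image_of_mem f z.2)) (by positivity)

theorem le_moreauEnv (hU : U.Nonempty) {u : E} {c : ℝ}
    (h : ∀ y ∈ U, c ≤ f y + ‖y - u‖ ^ 2 / 2) : c ≤ moreauEnv U f u :=
  have := hU.to_subtype
  le_ciInf fun y => h y y.2

theorem exists_lt_moreauEnv_add (hU : U.Nonempty) (u : E) {ε : ℝ} (hε : 0 < ε) :
    ∃ y ∈ U, f y + ‖y - u‖ ^ 2 / 2 < moreauEnv U f u + ε := by
  by_contra! h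
  linarith [le_moreauEnv hU h]

theorem convexOn_moreauEnv [NormedSpace ℝ E] (hf : ConvexOn ℝ U f) (hU : U.Nonempty)
    (hb : BddBelow (f '' U)) : ConvexOn ℝ Set.univ (moreauEnv U f) := by
  refine ⟨convex_univ, fun u _ v _ a b ha hb' hab => le_of_forall_pos_le_add fun ε hε => ?_⟩
  obtain ⟨y, hy, hyu⟩ := exists_lt_moreauEnv_add (f := f) hU u hε
  obtain ⟨z, hz, hzv⟩ := exists_lt_moreauEnv_add (f := f) hU v hε
  have hsq : ‖a • y + b • z - (a • u + b • v)‖ ^ 2 ≤ a * ‖y - u‖ ^ 2 + b * ‖z - v‖ ^ 2 := by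
    rw [show a • y + b • z - (a • u + b • v) = a • (y - u) + b • (z - v) by module]
    exact (convexOn_univ_norm.pow (fun _ _ => norm_nonneg _) 2).2 trivial trivial ha hb' hab
  have henv := moreauEnv_le hb (a • u + b • v) (hf.1 hy hz ha hb' hab)
  have hfc := hf.2 hy hz ha hb' hab
  simp only [smul_eq_mul] at hfc ⊢
  linarith [mul_le_mul_of_nonneg_left hyu.le ha, mul_le_mul_of_nonneg_left hzv.le hb',
    congrArg (· * ε) hab]

variable [InnerProductSpace ℝ E]

theorem moreauEnv_add_add_moreauEnv_sub_le (hU : U.Nonempty) (hf : BddBelow (f '' U)) (v h : E) :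
    moreauEnv U f (v + h) + moreauEnv U f (v - h) ≤ 2 * moreauEnv U f v + ‖h‖ ^ 2 := by
  suffices (moreauEnv U f (v + h) + moreauEnv U f (v - h) - ‖h‖ ^ 2) / 2 ≤ moreauEnv U f v by
    linarith
  refine le_moreauEnv hU fun y hy => ?_
  have hpar := parallelogram_law_with_norm ℝ (y - v) h
  rw [sub_sub, sub_add] at hpar
  linarith [moreauEnv_le hf (v + h) hy, moreauEnv_le hf (v - h) hy]

/-- The Moreau envelope near `x + s` determines the value at `x` of a function with approximate
subgradient `s` there. -/
theorem sub_le_of_moreauEnv_le (hg : BddBelow (g '' U)) {x s u : E} (hx : x ∈ U) {σ τ : ℝ}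
    (hs : ∀ y ∈ U, f x - τ + ⟪s, y - x⟫ ≤ f y)
    (hfg : moreauEnv U f u ≤ moreauEnv U g u + σ) :
    f x - g x ≤ σ + τ + ‖x + s - u‖ ^ 2 / 2 := by
  have hf : f x - τ + ‖x - u‖ ^ 2 / 2 - ‖x + s - u‖ ^ 2 / 2 ≤ moreauEnv U f u := by
    refine le_moreauEnv ⟨x, hx⟩ fun y hy => ?_
    have h1 := norm_add_sq_real (x - u) s
    have h2 := norm_add_sq_real (y - u) s
    have h3 := sq_nonneg ‖y - u + s‖
    have h4 : ⟪s, y - x⟫ = ⟪y - u, s⟫ - ⟪x - u, s⟫ := by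
      rw [← inner_sub_left, sub_sub_sub_cancel_right, real_inner_comm]
    rw [show x + s - u = x - u + s by abel]
    linarith [hs y hy]
  linarith [moreauEnv_le hg u hx]

theorem exists_approx_subgradient [CompleteSpace E] (hU : IsClosed U) (hf : ConvexOn ℝ U f)
    (hfc : LowerSemicontinuousOn f U) {M : ℝ} (hM : ∀ y ∈ U, |f y| ≤ M) {x : E} {r : ℝ}
    (hr : 0 < r) (hx : Metric.closedBall x r ⊆ U) {τ : ℝ} (hτ : 0 < τ) :
    ∃ s : E, ‖s‖ ≤ (2 * M + τ) / r ∧ ∀ y ∈ U, f x - τ + ⟪s, y - x⟫ ≤ f y := by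
  have hxU : x ∈ U := hx (Metric.mem_closedBall_self hr.le)
  obtain ⟨l, c, hl, hlx⟩ := ConvexOn.exists_affine_le_of_lt (𝕜 := ℝ) hxU (sub_lt_self (f x) hτ)
    hU hfc hf
  simp only [RCLike.re_to_real] at hlx
  have hle : ∀ y ∈ U, f x - τ + ⟪(InnerProductSpace.toDual ℝ E).symm l, y - x⟫ ≤ f y := by
    intro y hy
    have hly := hl ⟨y, hy⟩
    simp only [RCLike.re_to_real, Pi.add_apply, Set.domRestrict_apply, Function.comp_apply,
      Function.const_apply] at hly
    rw [InnerProductSpace.toDual_symm_apply, map_sub]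
    linarith
  refine ⟨_, ?_, hle⟩
  set s := (InnerProductSpace.toDual ℝ E).symm l
  have hy : x + (r / ‖s‖) • s ∈ Metric.closedBall x r := by
    rw [mem_closedBall_iff_norm, add_sub_cancel_left, norm_smul, norm_div, norm_norm,
      Real.norm_of_nonneg hr.le, div_mul_comm]
    exact mul_le_of_le_one_left hr.le (div_self_le_one _)
  have hsy := hle _ (hx hy)
  have hinner : ⟪s, (r / ‖s‖) • s⟫ = ‖s‖ * r := by
    rw [real_inner_smul_right, real_inner_self_eq_norm_sq]
    rcases eq_or_ne ‖s‖ 0 with h | h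
    · simp [h]
    · field_simp
  rw [add_sub_cancel_left, hinner] at hsy
  rw [le_div_iff₀ hr]
  linarith [abs_le.1 (hM _ (hx hy)), abs_le.1 (hM x hxU)]

end Moreau

section Cube

/-- Continuous convex functions on `U` with values in `[-1, 1]`. -/
def boundedConvex {E : Type*} [AddCommMonoid E] [Module ℝ E] [TopologicalSpace E] (U : Set E) :
    Set (E → ℝ) :=
  {f | ConvexOn ℝ U f ∧ ContinuousOn f U ∧ ∀ y ∈ U, |f y| ≤ 1}

/-- The cube `[0, 1]^d` enlarged to `[-1/2, 3/2]^d`. The margin around `[0, 1]^d` makes bounded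
convex functions Lipschitz there. -/
def enlargedCube (d : ℕ) : Set (EuclideanSpace ℝ (Fin d)) :=
  {x | ∀ i, x i ∈ Set.Icc (-1 / 2) (3 / 2)}

/-- The grid of mesh `δ` in `[-6, ∞)^d`. The slopes on `[0, 1]^d` of the functions in
`boundedConvex (enlargedCube d)` have norm at most `6`, so the grid has to cover `[-6, 7]^d`. -/
noncomputable def gridPoint {d : ℕ} (δ : ℝ) (m : Fin d → ℕ) : EuclideanSpace ℝ (Fin d) :=
  WithLp.toLp 2 fun i => -6 + δ * m i

/-- The values of the Moreau envelope of `f` on the grid of mesh `δ`, rounded down to multiples of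
`δ²`. -/
noncomputable def envCode {d : ℕ} (δ : ℝ) (f : EuclideanSpace ℝ (Fin d) → ℝ) (m : Fin d → ℕ) : ℤ :=
  ⌊moreauEnv (enlargedCube d) f (gridPoint δ m) / δ ^ 2⌋

theorem bddBelow_of_mem_boundedConvex {E : Type*} [AddCommMonoid E] [Module ℝ E]
    [TopologicalSpace E] {U : Set E} {f : E → ℝ} (hf : f ∈ boundedConvex U) :
    BddBelow (f '' U) :=
  ⟨-1, Set.forall_mem_image.2 fun y hy => (abs_le.1 (hf.2.2 y hy)).1⟩

variable {d : ℕ} {f g : EuclideanSpace ℝ (Fin d) → ℝ} {δ : ℝ}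

theorem zero_mem_enlargedCube : (0 : EuclideanSpace ℝ (Fin d)) ∈ enlargedCube d :=
  fun i => by norm_num

theorem isClosed_enlargedCube : IsClosed (enlargedCube d) := by
  simp only [enlargedCube, Set.ofPred_forall]
  exact isClosed_iInter fun i => isClosed_Icc.preimage (by fun_prop)

theorem closedBall_subset_enlargedCube {x : EuclideanSpace ℝ (Fin d)}
    (hx : ∀ i, x i ∈ Set.Icc 0 1) : Metric.closedBall x (1 / 2) ⊆ enlargedCube d := by
  intro y hy i
  have hi := (PiLp.norm_apply_le (y - x) i).trans (mem_closedBall_iff_norm.1 hy)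
  rw [PiLp.sub_apply, Real.norm_eq_abs, abs_le] at hi
  constructor <;> linarith [(hx i).1, (hx i).2]

theorem floor_sub_two_mul_floor_add_floor_mem {x y z : ℝ} (h0 : 0 ≤ x - 2 * y + z)
    (h1 : x - 2 * y + z ≤ 1) : ⌊x⌋ - 2 * ⌊y⌋ + ⌊z⌋ ∈ Finset.Icc (-1) 2 := by
  have hl : (-2 : ℝ) < (⌊x⌋ - 2 * ⌊y⌋ + ⌊z⌋ : ℤ) := by
    push_cast
    linarith [Int.lt_floor_add_one x, Int.floor_le y, Int.lt_floor_add_one z]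
  have hr : ((⌊x⌋ - 2 * ⌊y⌋ + ⌊z⌋ : ℤ) : ℝ) < 3 := by
    push_cast
    linarith [Int.floor_le x, Int.lt_floor_add_one y, Int.floor_le z]
  rw [Finset.mem_Icc]
  exact ⟨Int.add_one_le_of_lt (by exact_mod_cast hl), Int.lt_add_one_iff.1 (by exact_mod_cast hr)⟩

theorem gridPoint_add_single (m : Fin d → ℕ) (j : Fin d) (l : ℕ) :
    gridPoint δ (m + Pi.single j l) = gridPoint δ m + EuclideanSpace.single j (δ * l) := by
  ext i
  rcases eq_or_ne i j with rfl | hij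
  · simp [gridPoint]
    ring
  · simp [gridPoint, hij]

theorem secondDiff_envCode_mem (hf : f ∈ boundedConvex (enlargedCube d)) (hδ : 0 < δ) (j : Fin d)
    (m : Fin d → ℕ) : secondDiff (envCode δ f) j m ∈ Finset.Icc (-1) 2 := by
  have hU : (enlargedCube d).Nonempty := ⟨0, zero_mem_enlargedCube⟩
  set h : EuclideanSpace ℝ (Fin d) := EuclideanSpace.single j δ
  have hh : ‖h‖ ^ 2 = δ ^ 2 := by simp [h]
  set v := gridPoint δ (m + Pi.single j 1) with hv
  have hv1 : gridPoint δ (m + Pi.single j 2) = v + h := by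
    rw [hv, show Pi.single j 2 = Pi.single j 1 + Pi.single j 1 from Pi.single_add _ 1 1,
      ← add_assoc, gridPoint_add_single _ _ 1, Nat.cast_one, mul_one]
  have hv2 : gridPoint δ m = v - h := by
    rw [hv, gridPoint_add_single, Nat.cast_one, mul_one, add_sub_cancel_right]
  have hmid : v = (1 / 2 : ℝ) • (v + h) + (1 / 2 : ℝ) • (v - h) := by module
  have hconv := (convexOn_moreauEnv hf.1 hU (bddBelow_of_mem_boundedConvex hf)).2
    (Set.mem_univ (v + h)) (Set.mem_univ (v - h)) one_half_pos.le one_half_pos.le (add_halves 1)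
  have hsemi := moreauEnv_add_add_moreauEnv_sub_le hU (bddBelow_of_mem_boundedConvex hf) v h
  rw [← hmid, smul_eq_mul, smul_eq_mul] at hconv
  simp only [secondDiff, envCode, hv1, hv2, ← hv]
  refine floor_sub_two_mul_floor_add_floor_mem ?_ ?_
  · rw [← mul_div_assoc, ← sub_div, ← add_div]
    exact div_nonneg (by linarith) (by positivity)
  · rw [← mul_div_assoc, ← sub_div, ← add_div, div_le_one (by positivity)]
    linarith

theorem envCode_mem (hf : f ∈ boundedConvex (enlargedCube d)) (hδ : 0 < δ) (hδ1 : δ ≤ 1)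
    {m : Fin d → ℕ} (hm : ∀ i, m i < 2) :
    envCode δ f m ∈ Finset.Icc ⌊-1 / δ ^ 2⌋ ⌊(1 + 18 * d) / δ ^ 2⌋ := by
  have hf0 := abs_le.1 (hf.2.2 0 zero_mem_enlargedCube)
  have hnorm : ‖(0 : EuclideanSpace ℝ (Fin d)) - gridPoint δ m‖ ^ 2 ≤ d * 36 := by
    rw [zero_sub, norm_neg, EuclideanSpace.real_norm_sq_eq, ← nsmul_eq_mul]
    refine (Finset.sum_le_card_nsmul _ _ 36 fun i _ => ?_).trans_eq (by simp)
    have hmi : (m i : ℝ) ≤ 1 := by exact_mod_cast Nat.lt_succ_iff.1 (hm i)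
    have h1 : δ * m i ≤ 1 := mul_le_one₀ hδ1 (by positivity) hmi
    have h0 : 0 ≤ δ * m i := by positivity
    simp only [gridPoint]
    nlinarith
  have hle := moreauEnv_le (bddBelow_of_mem_boundedConvex hf) (gridPoint δ m) zero_mem_enlargedCube
  have hge : -1 ≤ moreauEnv (enlargedCube d) f (gridPoint δ m) :=
    le_moreauEnv ⟨0, zero_mem_enlargedCube⟩ fun y hy =>
      le_add_of_le_of_nonneg (abs_le.1 (hf.2.2 y hy)).1 (by positivity)
  rw [Finset.mem_Icc]
  constructor <;> refine Int.floor_le_floor (div_le_div_of_nonneg_right ?_ (by positivity)) <;>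
    linarith

theorem card_Icc_floor_le {x y : ℝ} (h : x ≤ y) :
    ((Finset.Icc ⌊x⌋ ⌊y⌋).card : ℝ) ≤ y - x + 2 := by
  have hxy : ((Finset.Icc ⌊x⌋ ⌊y⌋).card : ℤ) = ⌊y⌋ + 1 - ⌊x⌋ := by
    rw [Int.card_Icc, Int.toNat_of_nonneg]
    linarith [Int.floor_le_floor h]
  have hcast : ((Finset.Icc ⌊x⌋ ⌊y⌋).card : ℝ) = ⌊y⌋ + 1 - ⌊x⌋ := by exact_mod_cast hxy
  linarith [Int.floor_le y, Int.lt_floor_add_one x]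

theorem exists_gridPoint_near {n : ℕ} (hδ : 0 < δ) (hn : 13 / δ < n) {z : EuclideanSpace ℝ (Fin d)}
    (hz : ∀ i, z i ∈ Set.Icc (-6) 7) :
    ∃ m : Fin d → ℕ, (∀ i, m i < n) ∧ ‖z - gridPoint δ m‖ ^ 2 ≤ d * δ ^ 2 := by
  have hnn (i) : 0 ≤ (z i + 6) / δ := div_nonneg (by linarith [(hz i).1]) hδ.le
  refine ⟨fun i => ⌊(z i + 6) / δ⌋₊, fun i => (Nat.floor_lt (hnn i)).2 (lt_of_le_of_lt ?_ hn), ?_⟩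
  · gcongr
    linarith [(hz i).2]
  · rw [EuclideanSpace.real_norm_sq_eq, ← nsmul_eq_mul]
    refine (Finset.sum_le_card_nsmul _ _ (δ ^ 2) fun i _ => ?_).trans_eq (by simp)
    have h1 := (le_div_iff₀ hδ).1 (Nat.floor_le (hnn i))
    have h2 := (div_lt_iff₀ hδ).1 (Nat.lt_floor_add_one ((z i + 6) / δ))
    simp only [gridPoint, PiLp.sub_apply]
    exact pow_le_pow_left₀ (by linarith) (by linarith) 2

theorem sub_le_of_envCode_eq (hf : f ∈ boundedConvex (enlargedCube d))
    (hg : g ∈ boundedConvex (enlargedCube d)) (hδ : 0 < δ) (hδ1 : δ ≤ 1) {n : ℕ} (hn : 13 / δ < n)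
    (h : ∀ m : Fin d → ℕ, (∀ i, m i < n) → envCode δ f m = envCode δ g m)
    {x : EuclideanSpace ℝ (Fin d)} (hx : ∀ i, x i ∈ Set.Icc 0 1) :
    f x - g x ≤ (d + 2) * δ ^ 2 := by
  have hball := closedBall_subset_enlargedCube hx
  obtain ⟨s, hs6, hs⟩ := exists_approx_subgradient isClosed_enlargedCube hf.1
    hf.2.1.lowerSemicontinuousOn hf.2.2 one_half_pos hball (τ := δ ^ 2) (by positivity)
  have hs6' : ‖s‖ ≤ 6 := hs6.trans (by rw [div_le_iff₀ one_half_pos]; nlinarith)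
  obtain ⟨m, hmn, hm⟩ := exists_gridPoint_near hδ hn (z := x + s) fun i => by
    have hi := abs_le.1 ((PiLp.norm_apply_le s i).trans hs6')
    rw [PiLp.add_apply]
    constructor <;> linarith [(hx i).1, (hx i).2]
  have henv : moreauEnv (enlargedCube d) f (gridPoint δ m)
      ≤ moreauEnv (enlargedCube d) g (gridPoint δ m) + δ ^ 2 := by
    have hlt := (abs_lt.1 (Int.abs_sub_lt_one_of_floor_eq_floor (h m hmn))).2
    rw [← sub_div, div_lt_one (by positivity)] at hlt
    linarith
  have hxU : x ∈ enlargedCube d := hball (Metric.mem_closedBall_self one_half_pos.le)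
  linarith [sub_le_of_moreauEnv_le (bddBelow_of_mem_boundedConvex hg) hxU hs henv,
    sq_nonneg ‖x + s - gridPoint δ m‖]

theorem entropyLE_boundedConvex_of_mesh (hδ : 0 < δ) (hδ1 : δ ≤ 1) :
    EntropyLE (boundedConvex (enlargedCube d))
      (fun f g => ∀ x, (∀ i, x i ∈ Set.Icc (0 : ℝ) 1) → |f x - g x| ≤ (d + 2) * δ ^ 2)
      (2 ^ d * Real.log ((4 + 18 * d) / δ ^ 2) + (14 / δ) ^ d * Real.log 4) := by
  set A := Finset.Icc ⌊-1 / δ ^ 2⌋ ⌊(1 + 18 * d) / δ ^ 2⌋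
  set n := ⌊13 / δ⌋₊ + 1 with hn
  have hn14 : (n : ℝ) ≤ 14 / δ := by
    have h1 : (⌊13 / δ⌋₊ : ℝ) ≤ 13 / δ := Nat.floor_le (by positivity)
    have h2 : 1 ≤ 1 / δ := (one_le_div hδ).2 hδ1
    push_cast [hn]
    linarith [show 14 / δ = 13 / δ + 1 / δ by ring]
  have hδ2 : 1 ≤ 1 / δ ^ 2 := (one_le_div (by positivity)).2 (pow_le_one₀ hδ.le hδ1)
  have hle : -1 / δ ^ 2 ≤ (1 + 18 * d) / δ ^ 2 := by
    gcongr
    linarith [d.cast_nonneg (α := ℝ)]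
  have hA0 : 0 < A.card := Finset.card_pos.2 (Finset.nonempty_Icc.2 (Int.floor_le_floor hle))
  have hA : (A.card : ℝ) ≤ (4 + 18 * d) / δ ^ 2 :=
    calc (A.card : ℝ) ≤ (1 + 18 * d) / δ ^ 2 - -1 / δ ^ 2 + 2 * 1 := by
          simpa only [mul_one] using card_Icc_floor_le hle
      _ ≤ (1 + 18 * d) / δ ^ 2 - -1 / δ ^ 2 + 2 * (1 / δ ^ 2) := by gcongr
      _ = (4 + 18 * d) / δ ^ 2 := by ring
  refine (EntropyLE.of_secondDiff (envCode δ) n (fun f hf m hm => envCode_mem hf hδ hδ1 hm)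
    fun f hf j m => secondDiff_envCode_mem hf hδ j m).mono ?_ fun f hf g hg hfg x hx => ?_
  · rw [Fintype.card_fin, show (Finset.Icc (-1 : ℤ) 2).card = 4 from rfl]
    push_cast
    gcongr
  · have hlt : 13 / δ < n := by exact_mod_cast Nat.lt_floor_add_one (13 / δ)
    exact abs_sub_le_iff.2 ⟨sub_le_of_envCode_eq hf hg hδ hδ1 hlt hfg hx,
      sub_le_of_envCode_eq hg hf hδ hδ1 hlt (fun m hm => (hfg m hm).symm) hx⟩

theorem exists_entropyLE_boundedConvex (hd : 1 ≤ d) :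
    ∃ C : ℝ, 0 < C ∧ ∀ η : ℝ, 0 < η → EntropyLE (boundedConvex (enlargedCube d))
      (fun f g => ∀ x, (∀ i, x i ∈ Set.Icc (0 : ℝ) 1) → |f x - g x| ≤ η)
      (C * η ^ (-(d : ℝ) / 2)) := by
  have hd' : (0 : ℝ) < d / 2 := by positivity
  set C₀ : ℝ := 2 ^ d * ((4 + 18 * d) ^ ((d : ℝ) / 2) / (d / 2)) + 14 ^ d * Real.log 4
  have : 0 < C₀ := by positivity
  refine ⟨C₀ * (d + 2) ^ ((d : ℝ) / 2), by positivity, fun η hη => ?_⟩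
  rcases le_or_gt 2 η with hη2 | hη2
  · refine EntropyLE.of_forall (by positivity) fun f hf g hg x hx => ?_
    have hxU := closedBall_subset_enlargedCube hx (Metric.mem_closedBall_self one_half_pos.le)
    linarith [abs_sub (f x) (g x), hf.2.2 x hxU, hg.2.2 x hxU]
  set δ := √(η / (d + 2))
  have hδ0 : 0 < δ := by positivity
  have hδ2 : δ ^ 2 = η / (d + 2) := Real.sq_sqrt (by positivity)
  have hδ1 : δ ≤ 1 := Real.sqrt_le_one.2 ((div_le_one (by positivity)).2 (by linarith))
  have hpow : (1 / δ ^ 2) ^ ((d : ℝ) / 2) = (1 / δ) ^ d := by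
    rw [← one_div_pow, ← Real.rpow_natCast_mul (by positivity), Nat.cast_ofNat,
      mul_div_cancel₀ _ two_ne_zero, Real.rpow_natCast]
  have hlog : Real.log ((4 + 18 * d) / δ ^ 2)
      ≤ (4 + 18 * d) ^ ((d : ℝ) / 2) * (1 / δ) ^ d / (d / 2) := by
    rw [← hpow, ← Real.mul_rpow (by positivity) (by positivity), mul_one_div]
    exact Real.log_le_rpow_div (by positivity) hd'
  refine (entropyLE_boundedConvex_of_mesh hδ0 hδ1).mono ?_ fun f _ g _ hfg x hx => ?_
  · calc 2 ^ d * Real.log ((4 + 18 * d) / δ ^ 2) + (14 / δ) ^ d * Real.log 4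
        ≤ 2 ^ d * ((4 + 18 * d) ^ ((d : ℝ) / 2) * (1 / δ) ^ d / (d / 2))
          + (14 / δ) ^ d * Real.log 4 := by gcongr
      _ = C₀ * (1 / δ) ^ d := by
          simp only [C₀, div_pow, one_pow]
          ring
      _ = C₀ * (d + 2) ^ ((d : ℝ) / 2) * η ^ (-(d : ℝ) / 2) := by
          rw [← hpow, hδ2, one_div_div, Real.div_rpow (by positivity) hη.le, neg_div,
            Real.rpow_neg hη.le]
          ring
  · exact (hfg x hx).trans_eq (by rw [hδ2]; field_simp)

end Cube

section Pointwise

theorem exists_mem_add_sub_notMem {E : Type*} [NormedAddCommGroup E] [NormedSpace ℝ E]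
    [FiniteDimensional ℝ E] [MeasurableSpace E] [BorelSpace E] (μ : Measure E) [μ.IsAddHaarMeasure]
    {A S : Set E} (hA : 3 * μ A < μ S) (x : E) :
    ∃ y ∈ S, x + y ∉ A ∧ x - y ∉ A ∧ x + (2 : ℝ) • y ∉ A := by
  by_contra! hcon
  refine hA.not_ge ?_
  have hsub : S ⊆ ((x + ·) ⁻¹' A ∪ (x - ·) ⁻¹' A) ∪ ((2 : ℝ) • ·) ⁻¹' ((x + ·) ⁻¹' A) :=
    fun y hy => by
      by_cases h1 : x + y ∈ A
      · exact Or.inl (Or.inl h1)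
      by_cases h2 : x - y ∈ A
      · exact Or.inl (Or.inr h2)
      · exact Or.inr (hcon y hy h1 h2)
  have hadd : μ ((x + ·) ⁻¹' A) = μ A := measure_preimage_add _ _ _
  have hneg : μ ((x - ·) ⁻¹' A) = μ A :=
    (Measure.measurePreserving_sub_left μ x).measure_preimage_equiv
      (f := MeasurableEquiv.subLeft x) A
  have hsmul : μ (((2 : ℝ) • ·) ⁻¹' ((x + ·) ⁻¹' A)) ≤ μ A := by
    rw [Measure.addHaar_preimage_smul _ two_ne_zero, hadd]
    refine mul_le_of_le_one_left' ?_
    rw [ENNReal.ofReal_le_one, abs_of_nonneg (by positivity)]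
    exact inv_le_one_of_one_le₀ (one_le_pow₀ one_le_two)
  calc μ S ≤ μ A + μ A + μ A := (measure_mono hsub).trans <| (measure_union_le _ _).trans <|
        add_le_add ((measure_union_le _ _).trans (add_le_add hadd.le hneg.le)) hsmul
    _ = 3 * μ A := by ring

theorem abs_le_three_mul_of_convexOn {E : Type*} [AddCommGroup E] [Module ℝ E] {U : Set E}
    {f : E → ℝ} (hf : ConvexOn ℝ U f) {x y : E} {t : ℝ} (hadd : x + y ∈ U) (hsub : x - y ∈ U)
    (hadd₂ : x + (2 : ℝ) • y ∈ U) (h1 : |f (x + y)| ≤ t) (h2 : |f (x - y)| ≤ t)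
    (h3 : |f (x + (2 : ℝ) • y)| ≤ t) : |f x| ≤ 3 * t := by
  have hmid : x = (1 / 2 : ℝ) • (x + y) + (1 / 2 : ℝ) • (x - y) := by module
  have hxU : x ∈ U := by
    rw [hmid]
    exact hf.1 hadd hsub one_half_pos.le one_half_pos.le (add_halves 1)
  have c1 := hf.2 hadd hsub one_half_pos.le one_half_pos.le (add_halves 1)
  have c2 := hf.2 hxU hadd₂ one_half_pos.le one_half_pos.le (add_halves 1)
  rw [← hmid] at c1
  rw [show (1 / 2 : ℝ) • x + (1 / 2 : ℝ) • (x + (2 : ℝ) • y) = x + y by module] at c2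
  simp only [smul_eq_mul] at c1 c2
  rw [abs_le] at *
  constructor <;> linarith

theorem measure_lt_abs_le_of_eLpNorm_le {α : Type*} [MeasurableSpace α] {μ : Measure α}
    {p : ℝ≥0∞} (hp : p ≠ 0) {f : α → ℝ} (hf : AEStronglyMeasurable f μ) {B c : ℝ} (hB : 0 < B)
    (hc : 0 < c) (hfB : eLpNorm f p μ ≤ ENNReal.ofReal B) :
    μ {z | B * c ^ (-(p⁻¹).toReal) < |f z|} ≤ ENNReal.ofReal c := by
  rcases eq_or_ne p ∞ with rfl | hpt
  · refine (measure_mono_null (fun z hz => ?_) (ae_iff.1 (ae_le_eLpNormEssSup (f := f)))).trans_le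
      zero_le
    rw [eLpNorm_exponent_top] at hfB
    simp only [ENNReal.inv_top, ENNReal.toReal_zero, neg_zero, Real.rpow_zero, mul_one,
      Set.mem_ofPred_eq, not_le] at hz ⊢
    rw [Real.enorm_eq_ofReal_abs]
    exact hfB.trans_lt ((ENNReal.ofReal_lt_ofReal_iff (hB.trans hz)).2 hz)
  · have hp' : 0 < p.toReal := ENNReal.toReal_pos hp hpt
    set t := B * c ^ (-(p⁻¹).toReal) with ht
    have ht0 : 0 < t := by positivity
    have hBt : ENNReal.ofReal (t⁻¹ * B) ^ p.toReal = ENNReal.ofReal c := by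
      rw [ENNReal.ofReal_rpow_of_pos (by positivity), ht, Real.rpow_neg hc.le, mul_inv, inv_inv,
        mul_right_comm, inv_mul_cancel₀ hB.ne', one_mul, ENNReal.toReal_inv,
        Real.rpow_inv_rpow hc.le hp'.ne']
    calc μ {z | t < |f z|} ≤ μ {z | ENNReal.ofReal t ≤ ‖f z‖ₑ} := measure_mono fun z hz => by
          simp only [Set.mem_ofPred_eq, Real.enorm_eq_ofReal_abs] at hz ⊢
          exact ENNReal.ofReal_le_ofReal hz.le
      _ ≤ (ENNReal.ofReal t)⁻¹ ^ p.toReal * eLpNorm f p μ ^ p.toReal :=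
          meas_ge_le_mul_pow_eLpNorm_enorm μ hp hpt hf (by simpa using ht0) (by simp)
      _ ≤ (ENNReal.ofReal t)⁻¹ ^ p.toReal * ENNReal.ofReal B ^ p.toReal := by gcongr
      _ = ENNReal.ofReal c := by
          rw [← ENNReal.mul_rpow_of_nonneg _ _ hp'.le, ← ENNReal.ofReal_inv_of_pos ht0,
            ← ENNReal.ofReal_mul (by positivity), hBt]

theorem abs_le_of_convexOn_of_eLpNorm_le {E : Type*} [NormedAddCommGroup E] [NormedSpace ℝ E]
    [FiniteDimensional ℝ E] [MeasurableSpace E] [BorelSpace E] {μ : Measure E}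
    [μ.IsAddHaarMeasure] {p : ℝ≥0∞} (hp : p ≠ 0) {U S : Set E} {f : E → ℝ} (hf : ConvexOn ℝ U f)
    (hfm : AEStronglyMeasurable f (μ.restrict U)) {B v : ℝ} (hB : 0 < B) (hv : 0 < v)
    (hfB : eLpNorm f p (μ.restrict U) ≤ ENNReal.ofReal B) {x : E}
    (hS : ∀ y ∈ S, x + y ∈ U ∧ x - y ∈ U ∧ x + (2 : ℝ) • y ∈ U) (hvS : ENNReal.ofReal v ≤ μ S) :
    |f x| ≤ 3 * (B * (v / 4) ^ (-(p⁻¹).toReal)) := by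
  set t := B * (v / 4) ^ (-(p⁻¹).toReal)
  have hbad : μ ({z | t < |f z|} ∩ U) ≤ ENNReal.ofReal (v / 4) :=
    (Measure.le_restrict_apply U _).trans
      (measure_lt_abs_le_of_eLpNorm_le hp hfm hB (by positivity) hfB)
  have hlt : 3 * μ ({z | t < |f z|} ∩ U) < μ S :=
    calc 3 * μ ({z | t < |f z|} ∩ U) ≤ ENNReal.ofReal 3 * ENNReal.ofReal (v / 4) := by
          rw [ENNReal.ofReal_ofNat]
          gcongr
      _ = ENNReal.ofReal (3 * (v / 4)) := (ENNReal.ofReal_mul zero_le_three).symm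
      _ < ENNReal.ofReal v := (ENNReal.ofReal_lt_ofReal_iff hv).2 (by linarith)
      _ ≤ μ S := hvS
  obtain ⟨y, hy, h1, h2, h3⟩ := exists_mem_add_sub_notMem μ hlt x
  have hgood {z : E} (hz : z ∈ U) (h : z ∉ {z | t < |f z|} ∩ U) : |f z| ≤ t :=
    not_lt.1 fun hlt => h ⟨hlt, hz⟩
  obtain ⟨hadd, hsub, hadd₂⟩ := hS y hy
  exact abs_le_three_mul_of_convexOn hf hadd hsub hadd₂ (hgood hadd h1) (hgood hsub h2)
    (hgood hadd₂ h3)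

end Pointwise

section ConvexClass

variable {d : ℕ} {p : ℝ≥0∞} {a b : Fin d → ℝ} {B : ℝ} {f : (Fin d → ℝ) → ℝ}

theorem mem_convexClass_top :
    f ∈ convexClass ∞ a b B ↔ ConvexOn ℝ (Set.Icc a b) f ∧ ∀ x ∈ Set.Icc a b, |f x| ≤ B := by
  simp [convexClass]

theorem mem_convexClass_iff (hp : p ≠ 0) (hpt : p ≠ ∞) :
    f ∈ convexClass p a b B ↔ ConvexOn ℝ (Set.Icc a b) f ∧
      eLpNorm f p (volume.restrict (Set.Icc a b)) ≤ ENNReal.ofReal B := by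
  rw [eLpNorm_eq_lintegral_rpow_enorm_toReal hp hpt, one_div,
    ENNReal.rpow_inv_le_iff (ENNReal.toReal_pos hp hpt)]
  simp only [convexClass, hpt, if_false, Set.mem_ofPred_eq, Real.enorm_eq_ofReal_abs]

theorem eLpNorm_le_of_mem_convexClass (hp : p ≠ 0) (hf : f ∈ convexClass p a b B) :
    eLpNorm f p (volume.restrict (Set.Icc a b)) ≤ ENNReal.ofReal B := by
  rcases eq_or_ne p ∞ with rfl | hpt
  · rw [eLpNorm_exponent_top]
    refine eLpNormEssSup_le_of_ae_bound ?_
    filter_upwards [ae_restrict_mem measurableSet_Icc] with x hx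
      using (mem_convexClass_top.1 hf).2 x hx
  · exact ((mem_convexClass_iff hp hpt).1 hf).2

theorem abs_le_of_mem_convexClass (hp : p ≠ 0) (hB : 0 < B) (hf : f ∈ convexClass p a b B)
    {x h : Fin d → ℝ} (hh : ∀ i, 0 < h i) (hxl : ∀ i, a i ≤ x i - 2 * h i)
    (hxr : ∀ i, x i + 2 * h i ≤ b i) :
    |f x| ≤ 3 * (B * ((∏ i, 2 * h i) / 4) ^ (-(p⁻¹).toReal)) := by
  refine abs_le_of_convexOn_of_eLpNorm_le (S := Set.Icc (-h) h) hp hf.1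
    (memLp_of_mem_convexClass hp le_rfl hf).1 hB
    (Finset.prod_pos fun i _ => mul_pos two_pos (hh i)) (eLpNorm_le_of_mem_convexClass hp hf)
    (fun y hy => ?_) ?_
  · have hl (i) : -h i ≤ y i := hy.1 i
    have hr (i) : y i ≤ h i := hy.2 i
    refine ⟨⟨fun i => ?_, fun i => ?_⟩, ⟨fun i => ?_, fun i => ?_⟩, fun i => ?_, fun i => ?_⟩ <;>
      simp only [Pi.add_apply, Pi.sub_apply, Pi.smul_apply, smul_eq_mul] <;>
      linarith [hl i, hr i, hh i, hxl i, hxr i]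
  · rw [Real.volume_Icc_pi, ENNReal.ofReal_prod_of_nonneg fun i _ => by linarith [hh i]]
    refine (Finset.prod_congr rfl fun i _ => ?_).le
    rw [Pi.neg_apply, sub_neg_eq_add, two_mul]

/-- The affine map of the unit cube onto the box with least corner `a` and side lengths `l`. -/
def boxMap (a l : Fin d → ℝ) : (Fin d → ℝ) →ᵃ[ℝ] (Fin d → ℝ) :=
  AffineMap.const ℝ _ a + (LinearMap.mulLeft ℝ l).toAffineMap

@[simp]
theorem boxMap_apply (a l x : Fin d → ℝ) (i : Fin d) : boxMap a l x i = a i + l i * x i := rfl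

theorem boxMap_apply_div_sub (a : Fin d → ℝ) {l : Fin d → ℝ} (hl : ∀ i, l i ≠ 0)
    (y : Fin d → ℝ) : boxMap a l (fun i => (y i - a i) / l i) = y := by
  ext i
  rw [boxMap_apply, mul_div_cancel₀ _ (hl i), add_sub_cancel]

theorem boxMap_mem_Icc {α l : Fin d → ℝ} (hl : ∀ i, 0 < l i) {x : EuclideanSpace ℝ (Fin d)}
    (hx : x ∈ enlargedCube d) :
    boxMap α l x.ofLp ∈ Set.Icc (α - fun i => l i / 2) (α + fun i => 3 * l i / 2) := by
  constructor <;> intro i <;> simp only [boxMap_apply, Pi.sub_apply, Pi.add_apply] <;>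
    nlinarith [(hx i).1, (hx i).2, hl i]

theorem rescale_mem_boundedConvex (hp : p ≠ 0) (hB : 0 < B) (hf : f ∈ convexClass p a b B)
    {α l : Fin d → ℝ} (hl : ∀ i, 0 < l i) (hal : ∀ i, a i ≤ α i - l i)
    (hbl : ∀ i, α i + 2 * l i ≤ b i) :
    (fun x => f (boxMap α l x.ofLp) / (3 * (B * ((∏ i, l i / 2) / 4) ^ (-(p⁻¹).toReal))))
      ∈ boundedConvex (enlargedCube d) := by
  have hprod : 0 < ∏ i, l i / 2 := Finset.prod_pos fun i _ => half_pos (hl i)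
  set M := 3 * (B * ((∏ i, l i / 2) / 4) ^ (-(p⁻¹).toReal)) with hM
  have hM0 : 0 < M := by positivity
  let φ : EuclideanSpace ℝ (Fin d) →ᵃ[ℝ] (Fin d → ℝ) :=
    (boxMap α l).comp (WithLp.linearEquiv 2 ℝ (Fin d → ℝ)).toLinearMap.toAffineMap
  have hbd {x} (hx : x ∈ enlargedCube d) (i : Fin d) :
      a i + l i / 2 ≤ φ x i ∧ φ x i + l i / 2 ≤ b i := by
    obtain ⟨h1, h2⟩ := boxMap_mem_Icc (α := α) hl hx
    have h1i : α i - l i / 2 ≤ φ x i := h1 i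
    have h2i : φ x i ≤ α i + 3 * l i / 2 := h2 i
    constructor <;> linarith [hal i, hbl i]
  have hsub : enlargedCube d ⊆ φ ⁻¹' interior (Set.Icc a b) := by
    intro x hx
    rw [Set.mem_preimage, ← Set.pi_univ_Icc, interior_pi_set Set.finite_univ]
    intro i _
    change φ x i ∈ interior (Set.Icc (a i) (b i))
    rw [interior_Icc]
    constructor <;> linarith [hbd hx i, hl i]
  have hconv : Convex ℝ (enlargedCube d) := fun x hx y hy s t hs ht hst i =>
    convex_Icc (-1 / 2 : ℝ) (3 / 2) (hx i) (hy i) hs ht hst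
  refine ⟨?_, ?_, fun x hx => ?_⟩
  · simp only [div_eq_inv_mul]
    exact ((hf.1.comp_affineMap φ).subset (hsub.trans (Set.preimage_mono interior_subset))
      hconv).smul (inv_nonneg.2 hM0.le)
  · exact (hf.1.continuousOn_interior.comp φ.continuous_of_finiteDimensional.continuousOn
      hsub).div_const M
  · rw [abs_div, abs_of_pos hM0, div_le_one hM0]
    refine (abs_le_of_mem_convexClass hp hB hf (x := φ x) (h := fun i => l i / 4)
      (fun i => div_pos (hl i) four_pos) (fun i => by linarith [hbd hx i])
      (fun i => by linarith [hbd hx i])).trans_eq ?_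
    simp only [hM, show ∀ t : ℝ, 2 * (t / 4) = t / 2 by intro t; ring]

theorem entropyLE_convexClass_Icc {C : ℝ}
    (hC : ∀ η : ℝ, 0 < η → EntropyLE (boundedConvex (enlargedCube d))
      (fun f g => ∀ x, (∀ i, x i ∈ Set.Icc (0 : ℝ) 1) → |f x - g x| ≤ η)
      (C * η ^ (-(d : ℝ) / 2)))
    (hp : p ≠ 0) (hB : 0 < B) {α l : Fin d → ℝ} (hl : ∀ i, 0 < l i)
    (hal : ∀ i, a i ≤ α i - l i) (hbl : ∀ i, α i + 2 * l i ≤ b i) {ρ : ℝ} (hρ : 0 < ρ) :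
    EntropyLE (convexClass p a b B) (fun f g => ∀ x ∈ Set.Icc α (α + l), |f x - g x| ≤ ρ)
      (C * (ρ / (3 * (B * ((∏ i, l i / 2) / 4) ^ (-(p⁻¹).toReal)))) ^ (-(d : ℝ) / 2)) := by
  have hprod : 0 < ∏ i, l i / 2 := Finset.prod_pos fun i _ => half_pos (hl i)
  have hmem := fun f hf => rescale_mem_boundedConvex (f := f) hp hB hf hl hal hbl
  set M := 3 * (B * ((∏ i, l i / 2) / 4) ^ (-(p⁻¹).toReal))
  have hM0 : 0 < M := by positivity
  refine (hC (ρ / M) (by positivity)).comap le_rfl hmem fun f _ g _ hfg x hx => ?_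
  have hfgx := hfg (WithLp.toLp 2 fun i => (x i - α i) / l i) fun i =>
    ⟨div_nonneg (sub_nonneg.2 (hx.1 i)) (hl i).le,
      (div_le_one (hl i)).2 (sub_le_iff_le_add'.2 (hx.2 i))⟩
  simp only [boxMap_apply_div_sub α (fun i => (hl i).ne')] at hfgx
  rwa [← sub_div, abs_div, abs_of_pos hM0, div_le_div_iff_of_pos_right hM0] at hfgx

end ConvexClass

section Rescaling

theorem externalCoveringNumber_preimage_of_surjective {X Y : Type*} [PseudoEMetricSpace X]
    [PseudoEMetricSpace Y] {T : X → Y} (hT : T.Surjective) {ε δ : NNReal}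
    (h : ∀ x y, edist (T x) (T y) ≤ δ ↔ edist x y ≤ ε) (A : Set Y) :
    Metric.externalCoveringNumber ε (T ⁻¹' A) = Metric.externalCoveringNumber δ A := by
  refine le_antisymm (le_iInf₂ fun C hC => ?_) (le_iInf₂ fun C hC => ?_)
  · have hcov : Metric.IsCover ε (T ⁻¹' A) (Function.surjInv hT '' C) := fun x hx => by
      obtain ⟨y, hy, hxy⟩ := hC hx
      refine ⟨_, Set.mem_image_of_mem _ hy, (h _ _).1 ?_⟩
      rwa [Function.surjInv_eq hT]
    exact hcov.externalCoveringNumber_le_encard.trans (Set.encard_image_le _ _)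
  · have hcov : Metric.IsCover δ A (T '' C) := hT.forall.2 fun x hx => by
      obtain ⟨y, hy, hxy⟩ := hC hx
      exact ⟨_, Set.mem_image_of_mem _ hy, (h _ _).2 hxy⟩
    exact hcov.externalCoveringNumber_le_encard.trans (Set.encard_image_le _ _)

theorem convexOn_comp_affineMap_iff {E F : Type*} [AddCommGroup E] [Module ℝ E] [AddCommGroup F]
    [Module ℝ F] {φ : E →ᵃ[ℝ] F} (hφ : Function.Surjective φ) {s : Set F} {f : F → ℝ} :
    ConvexOn ℝ (φ ⁻¹' s) (f ∘ φ) ↔ ConvexOn ℝ s f := by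
  refine ⟨fun h => ⟨?_, ?_⟩, fun h => h.comp_affineMap φ⟩
  · rw [← Set.image_preimage_eq s hφ]
    exact h.1.affine_image φ
  · refine hφ.forall.2 fun x hx => hφ.forall.2 fun y hy u v hu hv huv => ?_
    rw [← Convex.combo_affine_apply huv]
    exact h.2 hx hy hu hv huv

variable {d : ℕ} {p q : ℝ≥0∞} {a b l : Fin d → ℝ} {B : ℝ} {f : (Fin d → ℝ) → ℝ}

theorem boxMap_injective (a : Fin d → ℝ) (hl : ∀ i, l i ≠ 0) :
    Function.Injective (boxMap a l) := fun _ _ hxy => funext fun i =>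
  mul_left_cancel₀ (hl i) (add_left_cancel (congrFun hxy i))

theorem boxMap_surjective (a : Fin d → ℝ) (hl : ∀ i, l i ≠ 0) :
    Function.Surjective (boxMap a l) :=
  fun y => ⟨_, boxMap_apply_div_sub a hl y⟩

theorem measurableEmbedding_boxMap (a : Fin d → ℝ) (hl : ∀ i, l i ≠ 0) :
    MeasurableEmbedding (boxMap a l) :=
  (boxMap a l).continuous_of_finiteDimensional.measurableEmbedding (boxMap_injective a hl)

theorem boxMap_preimage_Icc (hab : ∀ i, a i < b i) :
    boxMap a (b - a) ⁻¹' Set.Icc a b = Set.Icc 0 1 := by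
  ext x
  have hl (i) : 0 < b i - a i := sub_pos.2 (hab i)
  simp only [Set.mem_preimage, Set.mem_Icc, Pi.le_def, boxMap_apply, Pi.sub_apply, Pi.zero_apply,
    Pi.one_apply, le_add_iff_nonneg_right, ← le_sub_iff_add_le', hl, mul_nonneg_iff_of_pos_left,
    mul_le_iff_le_one_right]

theorem smul_map_boxMap_volume (a : Fin d → ℝ) (hl : ∀ i, 0 < l i) :
    ENNReal.ofReal (∏ i, l i) • Measure.map (boxMap a l) volume = volume := by
  have hcomp : (boxMap a l : (Fin d → ℝ) → Fin d → ℝ)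
      = (a + ·) ∘ Matrix.toLin' (Matrix.diagonal l) := by
    ext x i
    simp [Matrix.mulVec_diagonal]
  have hmeas : Measurable (Matrix.toLin' (Matrix.diagonal l)) :=
    (LinearMap.continuous_of_finiteDimensional _).measurable
  have hdet := Real.smul_map_diagonal_volume_pi (D := l) (by
    rw [Matrix.det_diagonal]
    exact (Finset.prod_pos fun i _ => hl i).ne')
  rw [Matrix.det_diagonal, abs_of_pos (Finset.prod_pos fun i _ => hl i)] at hdet
  rw [hcomp, ← Measure.map_map (measurable_const_add a) hmeas, ← Measure.map_smul, hdet,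
    map_add_left_eq_self]

theorem smul_map_boxMap_restrict (hab : ∀ i, a i < b i) :
    ENNReal.ofReal (∏ i, (b i - a i)) •
        Measure.map (boxMap a (b - a)) (volume.restrict (Set.Icc 0 1))
      = volume.restrict (Set.Icc a b) := by
  have hl (i) : 0 < (b - a) i := sub_pos.2 (hab i)
  rw [← boxMap_preimage_Icc hab,
    ← (measurableEmbedding_boxMap a fun i => (hl i).ne').restrict_map, ← Measure.restrict_smul]
  congr 1
  exact smul_map_boxMap_volume a hl

theorem eLpNorm_restrict_Icc_eq (hab : ∀ i, a i < b i) (f : (Fin d → ℝ) → ℝ) (p : ℝ≥0∞) :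
    eLpNorm f p (volume.restrict (Set.Icc a b))
      = ENNReal.ofReal (∏ i, (b i - a i)) ^ (p⁻¹).toReal *
        eLpNorm (f ∘ boxMap a (b - a)) p (volume.restrict (Set.Icc 0 1)) := by
  have hl (i) : 0 < (b - a) i := sub_pos.2 (hab i)
  have hV : ENNReal.ofReal (∏ i, (b i - a i)) ≠ 0 := by
    simpa using Finset.prod_pos fun i _ => hl i
  rw [← smul_map_boxMap_restrict hab, eLpNorm_smul_measure_of_ne_zero hV, one_div, smul_eq_mul,
    (measurableEmbedding_boxMap a fun i => (hl i).ne').eLpNorm_map_measure]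

theorem memLp_comp_boxMap_iff (hab : ∀ i, a i < b i) :
    MemLp (f ∘ boxMap a (b - a)) q (volume.restrict (Set.Icc 0 1))
      ↔ MemLp f q (volume.restrict (Set.Icc a b)) := by
  have hl (i) : 0 < (b - a) i := sub_pos.2 (hab i)
  have hV : ENNReal.ofReal (∏ i, (b i - a i)) ≠ 0 := by
    simpa using Finset.prod_pos fun i _ => hl i
  rw [← smul_map_boxMap_restrict hab,
    ← (measurableEmbedding_boxMap a fun i => (hl i).ne').memLp_map_measure_iff]
  refine ⟨fun h => h.smul_measure ENNReal.ofReal_ne_top, fun h => ?_⟩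
  simpa only [smul_smul, ENNReal.inv_mul_cancel hV ENNReal.ofReal_ne_top, one_smul] using
    h.smul_measure (ENNReal.inv_ne_top.2 hV)

theorem entropyScale_pos (hab : ∀ i, a i < b i) (hB : 0 < B) : 0 < entropyScale p q a b B :=
  mul_pos hB (Finset.prod_pos fun i _ => Real.rpow_pos_of_pos (sub_pos.2 (hab i)) _)

theorem entropyScale_self : entropyScale p p a b B = B := by
  simp [entropyScale]

theorem prod_rpow_mul_entropyScale_top (hab : ∀ i, a i < b i) :
    (∏ i, (b i - a i)) ^ (q⁻¹).toReal * entropyScale p ∞ a b B = entropyScale p q a b B := by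
  have hl (i) : 0 < b i - a i := sub_pos.2 (hab i)
  rw [entropyScale, entropyScale, ← Real.finsetProd_rpow _ _ fun i _ => (hl i).le, mul_left_comm,
    ← Finset.prod_mul_distrib]
  congr 1
  refine Finset.prod_congr rfl fun i _ => ?_
  rw [← Real.rpow_add (hl i), ENNReal.inv_top, ENNReal.toReal_zero, zero_sub, ← sub_eq_add_neg]

/-- The transport of a function from the box `[a, b]` to the unit cube, normalised so that
`C_p([a, b], B)` corresponds to `C_p([0, 1]^d, 1)`. The normalising factor is the scale of the
class in the supremum norm. -/
noncomputable def toUnitCube (p : ℝ≥0∞) (a b : Fin d → ℝ) (B : ℝ) (f : (Fin d → ℝ) → ℝ) :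
    (Fin d → ℝ) → ℝ :=
  (entropyScale p ∞ a b B)⁻¹ • (f ∘ boxMap a (b - a))

theorem eLpNorm_eq_entropyScale_mul (hab : ∀ i, a i < b i) (hB : 0 < B) :
    eLpNorm f q (volume.restrict (Set.Icc a b)) = ENNReal.ofReal (entropyScale p q a b B) *
      eLpNorm (toUnitCube p a b B f) q (volume.restrict (Set.Icc 0 1)) := by
  have hV : 0 < ∏ i, (b i - a i) := Finset.prod_pos fun i _ => sub_pos.2 (hab i)
  have hc : 0 < entropyScale p ∞ a b B := entropyScale_pos hab hB
  rw [← prod_rpow_mul_entropyScale_top hab, ENNReal.ofReal_mul (by positivity),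
    ← ENNReal.ofReal_rpow_of_pos hV, mul_assoc, toUnitCube, eLpNorm_const_smul,
    Real.enorm_of_nonneg (by positivity), ENNReal.ofReal_inv_of_pos hc,
    ENNReal.mul_inv_cancel_left (by simpa using hc) ENNReal.ofReal_ne_top,
    eLpNorm_restrict_Icc_eq hab]

theorem toUnitCube_mem_convexClass_iff (hp : p ≠ 0) (hab : ∀ i, a i < b i) (hB : 0 < B) :
    toUnitCube p a b B f ∈ convexClass p 0 1 1 ↔ f ∈ convexClass p a b B := by
  have hc : 0 < entropyScale p ∞ a b B := entropyScale_pos hab hB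
  have hsurj := boxMap_surjective a (l := b - a) fun i => (sub_pos.2 (hab i)).ne'
  have hconv : ConvexOn ℝ (Set.Icc 0 1) (toUnitCube p a b B f) ↔ ConvexOn ℝ (Set.Icc a b) f := by
    rw [← convexOn_comp_affineMap_iff hsurj (f := f), boxMap_preimage_Icc hab]
    refine ⟨fun h => ?_, fun h => h.smul (inv_nonneg.2 hc.le)⟩
    simpa only [toUnitCube, Pi.smul_apply, smul_inv_smul₀ hc.ne'] using! h.smul hc.le
  rcases eq_or_ne p ∞ with rfl | hpt
  · rw [mem_convexClass_top, mem_convexClass_top, hconv, ← boxMap_preimage_Icc hab]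
    refine and_congr_right fun _ => .trans (forall₂_congr fun x _ => ?_)
      (hsurj.forall (p := fun y => y ∈ Set.Icc a b → |f y| ≤ B)).symm
    rw [toUnitCube, entropyScale_self, Pi.smul_apply, smul_eq_mul, abs_mul, abs_inv, abs_of_pos hB,
      inv_mul_le_one₀ hB, Function.comp_apply]
  · rw [mem_convexClass_iff hp hpt, mem_convexClass_iff hp hpt, hconv,
      eLpNorm_eq_entropyScale_mul (p := p) (q := p) hab hB, entropyScale_self, ENNReal.ofReal_one]
    refine and_congr_right fun _ => ?_
    nth_rw 2 [← mul_one (ENNReal.ofReal B)]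
    rw [ENNReal.mul_le_mul_iff_right (by simpa using hB) ENNReal.ofReal_ne_top]

theorem exists_toUnitCube_eq (p : ℝ≥0∞) (hab : ∀ i, a i < b i) (hB : 0 < B)
    {g : (Fin d → ℝ) → ℝ} (hg : MemLp g q (volume.restrict (Set.Icc 0 1))) :
    ∃ f, MemLp f q (volume.restrict (Set.Icc a b)) ∧ toUnitCube p a b B f = g := by
  have hc : 0 < entropyScale p ∞ a b B := entropyScale_pos hab hB
  obtain ⟨φ, hφ⟩ :=
    (boxMap_injective a (l := b - a) fun i => (sub_pos.2 (hab i)).ne').hasLeftInverse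
  have hcomp : (entropyScale p ∞ a b B • (g ∘ φ)) ∘ boxMap a (b - a)
      = entropyScale p ∞ a b B • g := by
    ext x
    simp [hφ x]
  refine ⟨entropyScale p ∞ a b B • (g ∘ φ), (memLp_comp_boxMap_iff hab).1 ?_, ?_⟩
  · rw [hcomp]
    exact hg.const_smul _
  · rw [toUnitCube, hcomp, inv_smul_smul₀ hc.ne']

theorem convexEntropy_eq_unitCube [Fact (1 ≤ q)] (hp : p ≠ 0) (hab : ∀ i, a i < b i) (hB : 0 < B)
    (ε : ℝ) :
    convexEntropy p q a b B ε
      = convexEntropy p q (0 : Fin d → ℝ) 1 1 (ε / entropyScale p q a b B) := by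
  have hS : 0 < entropyScale p q a b B := entropyScale_pos hab hB
  let T (f : LqFun q (volume.restrict (Set.Icc a b))) :
      LqFun q (volume.restrict (Set.Icc (0 : Fin d → ℝ) 1)) :=
    ⟨toUnitCube p a b B f.1, ((memLp_comp_boxMap_iff hab).2 f.2).const_smul _⟩
  have hT : Function.Surjective T := fun g => by
    obtain ⟨f, hf, hfg⟩ := exists_toUnitCube_eq p hab hB g.2
    exact ⟨⟨f, hf⟩, Subtype.ext hfg⟩
  have hdist (f g) : edist (T f) (T g) ≤ (ε / entropyScale p q a b B).toNNReal
      ↔ edist f g ≤ ε.toNNReal := by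
    have hfg : edist f g = ENNReal.ofReal (entropyScale p q a b B) * edist (T f) (T g) := by
      refine (eLpNorm_eq_entropyScale_mul (p := p) hab hB).trans ?_
      congr 2
      ext x
      exact mul_sub _ _ _
    change _ ↔ _ ≤ ENNReal.ofReal ε
    nth_rw 2 [← mul_div_cancel₀ ε hS.ne']
    rw [hfg, ENNReal.ofReal_mul hS.le,
      ENNReal.mul_le_mul_iff_right (by simpa using hS) ENNReal.ofReal_ne_top]
    rfl
  rw [convexEntropy, convexEntropy, ← externalCoveringNumber_preimage_of_surjective hT hdist]
  congr 3
  exact Set.ext fun f => (toUnitCube_mem_convexClass_iff hp hab hB).symm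

end Rescaling

section Dyadic

/-- The length of the dyadic interval with index `j`. -/
noncomputable def dyadicLen (j : ℕ × Bool) : ℝ := 1 / 4 * (1 / 2) ^ j.1

/-- The left end point of the dyadic interval with index `j`. The intervals, whose lengths are
comparable with their distances to `{0, 1}`, accumulate at `0` for `j.2 = false` and at `1` for
`j.2 = true`. -/
noncomputable def dyadicLeft (j : ℕ × Bool) : ℝ :=
  if j.2 then 1 - 2 * dyadicLen j else dyadicLen j

theorem dyadicLen_pos (j : ℕ × Bool) : 0 < dyadicLen j := by
  unfold dyadicLen
  positivity

theorem dyadicLen_le (j : ℕ × Bool) : dyadicLen j ≤ 1 / 4 :=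
  mul_le_of_le_one_right (by norm_num) (pow_le_one₀ (by norm_num) (by norm_num))

theorem dyadicLen_le_dyadicLeft (j : ℕ × Bool) : dyadicLen j ≤ dyadicLeft j := by
  unfold dyadicLeft
  split_ifs
  · linarith [dyadicLen_le j]
  · exact le_rfl

theorem dyadicLeft_add_le (j : ℕ × Bool) : dyadicLeft j + 2 * dyadicLen j ≤ 1 := by
  unfold dyadicLeft
  split_ifs
  · linarith
  · linarith [dyadicLen_le j]

theorem exists_dyadicLen_near {y : ℝ} (hy : 0 < y) (hy' : y ≤ 1 / 2) (t : Bool) :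
    ∃ n : ℕ, dyadicLen (n, t) ≤ y ∧ y ≤ 2 * dyadicLen (n, t) := by
  obtain ⟨n, hn, hn'⟩ := exists_nat_pow_near_of_lt_one (x := 2 * y) (y := (1 / 2 : ℝ))
    (by linarith) (by linarith) (by norm_num) (by norm_num)
  rw [pow_succ] at hn
  exact ⟨n, by unfold dyadicLen; linarith, by unfold dyadicLen; linarith⟩

theorem exists_mem_Icc_dyadic {x : ℝ} (hx : x ∈ Set.Ioo 0 1) :
    ∃ j, x ∈ Set.Icc (dyadicLeft j) (dyadicLeft j + dyadicLen j) := by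
  rcases le_total x (1 / 2) with h | h
  · obtain ⟨n, hn, hn'⟩ := exists_dyadicLen_near hx.1 h false
    refine ⟨(n, false), ?_, ?_⟩ <;> simp only [dyadicLeft, Bool.false_eq_true, if_false] <;>
      linarith
  · obtain ⟨n, hn, hn'⟩ := exists_dyadicLen_near (sub_pos.2 hx.2) (by linarith) true
    refine ⟨(n, true), ?_, ?_⟩ <;> simp only [dyadicLeft, if_true] <;> linarith

theorem summable_dyadicLen_rpow {t : ℝ} (ht : 0 < t) : Summable fun j => dyadicLen j ^ t := by
  have hgeom : Summable fun n : ℕ => (1 / 4 : ℝ) ^ t * ((1 / 2 : ℝ) ^ t) ^ n :=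
    (summable_geometric_of_lt_one (by positivity)
      (Real.rpow_lt_one (by norm_num) (by norm_num) ht)).mul_left _
  refine (hgeom.mul_of_nonneg (Summable.of_finite (f := fun _ : Bool => (1 : ℝ)))
    (fun n => by positivity) (fun _ => zero_le_one)).congr fun j => ?_
  rw [dyadicLen, mul_one, Real.mul_rpow (by norm_num) (by positivity), Real.rpow_pow_comm]
  norm_num

theorem summable_fin_prod_of_nonneg {J : Type*} {f : J → ℝ} (hf : Summable f) (h0 : ∀ j, 0 ≤ f j)
    (d : ℕ) : Summable fun k : Fin d → J => ∏ i, f (k i) := by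
  induction d with
  | zero => exact Summable.of_finite
  | succ d ih =>
    rw [← (Fin.consEquiv fun _ : Fin (d + 1) => J).summable_iff]
    refine (hf.mul_of_nonneg ih h0 fun k => Finset.prod_nonneg fun i _ => h0 _).congr fun k => ?_
    simp [Fin.prod_univ_succ, Fin.consEquiv]

variable {d : ℕ} (k : Fin d → ℕ × Bool)

/-- The product of the dyadic intervals with indices `k i`. -/
def dyadicBox : Set (Fin d → ℝ) :=
  Set.Icc (fun i => dyadicLeft (k i)) ((fun i => dyadicLeft (k i)) + fun i => dyadicLen (k i))

/-- The volume of the dyadic box with index `k`. -/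
noncomputable def dyadicVol : ℝ := ∏ i, dyadicLen (k i)

theorem dyadicVol_pos : 0 < dyadicVol k := Finset.prod_pos fun _ _ => dyadicLen_pos _

theorem summable_dyadicVol_rpow (d : ℕ) {t : ℝ} (ht : 0 < t) :
    Summable fun k : Fin d → ℕ × Bool => dyadicVol k ^ t :=
  (summable_fin_prod_of_nonneg (summable_dyadicLen_rpow ht)
    (fun j => Real.rpow_nonneg (dyadicLen_pos j).le t) d).congr fun _ =>
      Real.finsetProd_rpow _ _ (fun _ _ => (dyadicLen_pos _).le) t

theorem volume_dyadicBox : volume (dyadicBox k) = ENNReal.ofReal (dyadicVol k) := by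
  rw [dyadicBox, Real.volume_Icc_pi, dyadicVol,
    ENNReal.ofReal_prod_of_nonneg fun i _ => (dyadicLen_pos (k i)).le]
  simp only [Pi.add_apply, add_sub_cancel_left]

theorem ae_exists_mem_dyadicBox (d : ℕ) :
    ∀ᵐ x ∂volume.restrict (Set.Icc (0 : Fin d → ℝ) 1), ∃ k, x ∈ dyadicBox k := by
  have hae : (Set.univ.pi fun _ : Fin d => Set.Ioo (0 : ℝ) 1) =ᵐ[volume] Set.Icc 0 1 :=
    Measure.univ_pi_Ioo_ae_eq_Icc
  rw [← Measure.restrict_congr_set hae]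
  filter_upwards [ae_restrict_mem (MeasurableSet.univ_pi fun _ => measurableSet_Ioo)] with x hx
  choose k hk using fun i => exists_mem_Icc_dyadic (hx i trivial)
  exact ⟨k, fun i => (hk i).1, fun i => (hk i).2⟩

end Dyadic

section UpperBound

theorem eLpNorm_rpow_le_tsum {α E ι : Type*} [MeasurableSpace α] {μ : Measure α}
    [NormedAddCommGroup E] [Countable ι] {f : α → E} {q : ℝ≥0∞} (hq : q ≠ 0) (hqt : q ≠ ∞)
    {s : ι → Set α} (hs : ∀ k, MeasurableSet (s k)) (hcover : ∀ᵐ x ∂μ, ∃ k, x ∈ s k)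
    {ρ : ι → ℝ≥0∞} (hf : ∀ k, ∀ x ∈ s k, ‖f x‖ₑ ≤ ρ k) :
    eLpNorm f q μ ^ q.toReal ≤ ∑' k, ρ k ^ q.toReal * μ (s k) := by
  have hunion : μ.restrict (⋃ k, s k) = μ :=
    Measure.restrict_eq_self_of_ae_mem (hcover.mono fun x => Set.mem_iUnion.2)
  rw [eLpNorm_eq_lintegral_rpow_enorm_toReal hq hqt, one_div,
    ENNReal.rpow_inv_rpow (ENNReal.toReal_pos hq hqt).ne', ← hunion]
  refine (lintegral_iUnion_le _ _).trans (ENNReal.tsum_le_tsum fun k => ?_)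
  calc ∫⁻ x in s k, ‖f x‖ₑ ^ q.toReal ∂μ ≤ ∫⁻ _ in s k, ρ k ^ q.toReal ∂μ :=
        setLIntegral_mono' (hs k) fun x hx =>
          ENNReal.rpow_le_rpow (hf k x hx) ENNReal.toReal_nonneg
    _ = ρ k ^ q.toReal * μ (s k) := setLIntegral_const _ _
    _ ≤ _ := by rw [hunion]

variable {d : ℕ} {p q : ℝ≥0∞}

theorem exists_eLpNorm_le_of_dyadicBox (d : ℕ) (hq : q ≠ 0) (hqt : q ≠ ∞) {s : ℝ}
    (hs : s < (q⁻¹).toReal) :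
    ∃ K : ℝ, 0 < K ∧ ∀ (f : (Fin d → ℝ) → ℝ) (ρ : ℝ), 0 < ρ →
      (∀ k, ∀ x ∈ dyadicBox k, |f x| ≤ ρ * dyadicVol k ^ (-s)) →
      eLpNorm f q (volume.restrict (Set.Icc 0 1)) ≤ ENNReal.ofReal (K * ρ) := by
  have hq' : 0 < q.toReal := ENNReal.toReal_pos hq hqt
  have ht : 0 < 1 - s * q.toReal := by
    rwa [sub_pos, ← lt_div_iff₀ hq', one_div, ← ENNReal.toReal_inv]
  have hsum := summable_dyadicVol_rpow d ht
  set Z := ∑' k : Fin d → ℕ × Bool, dyadicVol k ^ (1 - s * q.toReal)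
  have hZ : 0 < Z := hsum.tsum_pos (fun k => (Real.rpow_pos_of_pos (dyadicVol_pos k) _).le)
    (fun _ => (0, false)) (Real.rpow_pos_of_pos (dyadicVol_pos _) _)
  refine ⟨Z ^ (q⁻¹).toReal, by positivity, fun f ρ hρ hf => ?_⟩
  have hterm (k : Fin d → ℕ × Bool) :
      ENNReal.ofReal (ρ * dyadicVol k ^ (-s)) ^ q.toReal * ENNReal.ofReal (dyadicVol k)
        = ENNReal.ofReal (ρ ^ q.toReal * dyadicVol k ^ (1 - s * q.toReal)) := by
    have hv := dyadicVol_pos k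
    rw [ENNReal.ofReal_rpow_of_pos (by positivity), ← ENNReal.ofReal_mul (by positivity),
      Real.mul_rpow hρ.le (by positivity), ← Real.rpow_mul hv.le, mul_assoc,
      ← Real.rpow_add_one hv.ne']
    ring_nf
  rw [← ENNReal.rpow_le_rpow_iff hq']
  calc eLpNorm f q (volume.restrict (Set.Icc 0 1)) ^ q.toReal
      ≤ ∑' k : Fin d → ℕ × Bool, ENNReal.ofReal (ρ * dyadicVol k ^ (-s)) ^ q.toReal *
          volume.restrict (Set.Icc 0 1) (dyadicBox k) :=
        eLpNorm_rpow_le_tsum hq hqt (fun _ => measurableSet_Icc) (ae_exists_mem_dyadicBox d)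
          fun k x hx => by
            rw [Real.enorm_eq_ofReal_abs]
            exact ENNReal.ofReal_le_ofReal (hf k x hx)
    _ ≤ ∑' k : Fin d → ℕ × Bool, ENNReal.ofReal (ρ ^ q.toReal *
          dyadicVol k ^ (1 - s * q.toReal)) := by
        gcongr with k
        rw [← hterm, ← volume_dyadicBox]
        gcongr
        exact Measure.restrict_le_self
    _ = ENNReal.ofReal (Z ^ (q⁻¹).toReal * ρ) ^ q.toReal := by
        rw [← ENNReal.ofReal_tsum_of_nonneg (fun k => by have := dyadicVol_pos k; positivity)
          (hsum.mul_left _), tsum_mul_left, ENNReal.ofReal_rpow_of_pos (by positivity),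
          Real.mul_rpow (by positivity) hρ.le, ENNReal.toReal_inv, Real.rpow_inv_rpow hZ.le hq'.ne',
          mul_comm]

theorem exists_entropyLE_dyadicBox (hd : 1 ≤ d) (hp : p ≠ 0) :
    ∃ C : ℝ, 0 < C ∧ ∀ (k : Fin d → ℕ × Bool) (ρ : ℝ), 0 < ρ →
      EntropyLE (convexClass p 0 1 1) (fun f g => ∀ x ∈ dyadicBox k, |f x - g x| ≤ ρ)
        (C * (ρ * dyadicVol k ^ (p⁻¹).toReal) ^ (-(d : ℝ) / 2)) := by
  obtain ⟨C, hC0, hC⟩ := exists_entropyLE_boundedConvex hd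
  set A : ℝ := 3 * (4 * 2 ^ d) ^ (p⁻¹).toReal with hA
  refine ⟨C * A⁻¹ ^ (-(d : ℝ) / 2), by positivity, fun k ρ hρ => ?_⟩
  have hv := dyadicVol_pos k
  refine (entropyLE_convexClass_Icc hC hp one_pos (fun i => dyadicLen_pos (k i)) (fun i => ?_)
    (fun i => ?_) hρ).mono (le_of_eq ?_) fun f _ g _ h => h
  · exact sub_nonneg.2 (dyadicLen_le_dyadicLeft (k i))
  · exact dyadicLeft_add_le (k i)
  · have hprod : (∏ i, dyadicLen (k i) / 2) / 4 = dyadicVol k / (4 * 2 ^ d) := by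
      rw [Finset.prod_div_distrib, Finset.prod_const, Finset.card_univ, Fintype.card_fin,
        div_div, mul_comm, dyadicVol]
    rw [mul_assoc, ← Real.mul_rpow (by positivity) (by positivity), hprod, one_mul,
      Real.rpow_neg (by positivity), Real.div_rpow hv.le (by positivity), inv_div, hA]
    congr 2
    field_simp

theorem exists_entropyLE_forall_dyadicBox (hd : 1 ≤ d) (hp : p ≠ 0) {s : ℝ}
    (hs : (p⁻¹).toReal < s) :
    ∃ C : ℝ, 0 < C ∧ ∀ ρ : ℝ, 0 < ρ → EntropyLE (convexClass p (0 : Fin d → ℝ) 1 1)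
      (fun f g => ∀ k, ∀ x ∈ dyadicBox k, |f x - g x| ≤ ρ * dyadicVol k ^ (-s))
      (C * ρ ^ (-(d : ℝ) / 2)) := by
  obtain ⟨C, hC0, hC⟩ := exists_entropyLE_dyadicBox hd hp
  have ht : 0 < (s - (p⁻¹).toReal) * (d / 2) :=
    mul_pos (sub_pos.2 hs) (half_pos (Nat.cast_pos.2 hd))
  have hsum := summable_dyadicVol_rpow d ht
  set Z := ∑' k : Fin d → ℕ × Bool, dyadicVol k ^ ((s - (p⁻¹).toReal) * (d / 2))
  have hZ : 0 < Z := hsum.tsum_pos (fun k => (Real.rpow_pos_of_pos (dyadicVol_pos k) _).le)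
    (fun _ => (0, false)) (Real.rpow_pos_of_pos (dyadicVol_pos _) _)
  refine ⟨C * Z, by positivity, fun ρ hρ => ?_⟩
  have hterm (k : Fin d → ℕ × Bool) :
      C * (ρ * dyadicVol k ^ (-s) * dyadicVol k ^ (p⁻¹).toReal) ^ (-(d : ℝ) / 2)
        = C * ρ ^ (-(d : ℝ) / 2) * dyadicVol k ^ ((s - (p⁻¹).toReal) * (d / 2)) := by
    have hv := dyadicVol_pos k
    rw [mul_assoc ρ, ← Real.rpow_add hv, Real.mul_rpow hρ.le (by positivity), ← Real.rpow_mul hv.le,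
      mul_assoc]
    ring_nf
  have hcode := EntropyLE.forall_tsum
    (((hsum.mul_left (C * ρ ^ (-(d : ℝ) / 2)))).congr fun k => (hterm k).symm)
    (fun k => by have := dyadicVol_pos k; positivity)
    fun k => hC k _ (mul_pos hρ (Real.rpow_pos_of_pos (dyadicVol_pos k) _))
  simp only [hterm, tsum_mul_left] at hcode
  rwa [mul_right_comm]

theorem EntropyLE.convexEntropy_le [Fact (1 ≤ q)] {a b : Fin d → ℝ} {B ε H : ℝ}
    (h : EntropyLE (convexClass p a b B) (fun f g =>
      eLpNorm (fun x => f x - g x) q (volume.restrict (Set.Icc a b)) ≤ ENNReal.ofReal ε) H) :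
    convexEntropy p q a b B ε ≤ (H : EReal) :=
  (h.comap le_rfl (φ := Subtype.val) (fun _ hf => hf) fun _ _ _ _ hfg => hfg)
    |>.log_externalCoveringNumber_le

theorem exists_convexEntropy_unitCube_le (hd : 1 ≤ d) [Fact (1 ≤ q)] (hqp : q < p) :
    ∃ c : ℝ, 0 < c ∧ ∀ ε : ℝ, 0 < ε →
      convexEntropy p q (0 : Fin d → ℝ) 1 1 ε ≤ ((c * ε ^ (-(d : ℝ) / 2) : ℝ) : EReal) := by
  have hq : q ≠ 0 := (one_pos.trans_le Fact.out).ne'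
  have hPQ : (p⁻¹).toReal < (q⁻¹).toReal :=
    (ENNReal.toReal_lt_toReal (ENNReal.inv_ne_top.2 hqp.ne_bot) (ENNReal.inv_ne_top.2 hq)).2
      (ENNReal.inv_lt_inv.2 hqp)
  obtain ⟨s, hPs, hsQ⟩ := exists_between hPQ
  obtain ⟨C, hC0, hC⟩ := exists_entropyLE_forall_dyadicBox hd hqp.ne_bot hPs
  obtain ⟨K, hK0, hK⟩ := exists_eLpNorm_le_of_dyadicBox d hq hqp.ne_top hsQ
  refine ⟨C * K⁻¹ ^ (-(d : ℝ) / 2), by positivity, fun ε hε => ?_⟩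
  refine ((hC (K⁻¹ * ε) (by positivity)).mono (le_of_eq ?_) fun f _ g _ hfg => ?_).convexEntropy_le
  · rw [Real.mul_rpow (by positivity) hε.le, mul_assoc]
  · simpa only [mul_inv_cancel_left₀ hK0.ne'] using
      hK (fun x => f x - g x) (K⁻¹ * ε) (by positivity) hfg

end UpperBound

section Packing

theorem card_filter_eight_mul_card_le (J : Type*) [Fintype J] :
    ((Finset.univ.filter fun ζ : Finset J => 8 * ζ.card ≤ Fintype.card J).card : ℝ)
      ≤ (5 / 3) ^ Fintype.card J := by
  classical
  set N := Fintype.card J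
  have hweight (ζ : Finset J) (hζ : 8 * ζ.card ≤ N) : (9 / 10 : ℝ) ^ N ≤ (1 / 2) ^ ζ.card :=
    calc (9 / 10 : ℝ) ^ N ≤ (9 / 10) ^ (8 * ζ.card) :=
          pow_le_pow_of_le_one (by norm_num) (by norm_num) hζ
      _ = ((9 / 10) ^ 8) ^ ζ.card := pow_mul _ _ _
      _ ≤ (1 / 2) ^ ζ.card := by gcongr; norm_num
  have htotal : ∑ ζ : Finset J, (1 / 2 : ℝ) ^ ζ.card = (3 / 2) ^ N := by
    have := Finset.sum_pow_mul_eq_add_pow (1 / 2 : ℝ) 1 (Finset.univ : Finset J)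
    simp only [one_pow, mul_one, Finset.powerset_univ, Finset.card_univ] at this
    rw [this, show (1 / 2 + 1 : ℝ) = 3 / 2 by norm_num]
  set 𝓢 := Finset.univ.filter fun ζ : Finset J => 8 * ζ.card ≤ N
  have hmul : (𝓢.card : ℝ) * (9 / 10) ^ N ≤ (3 / 2) ^ N :=
    calc (𝓢.card : ℝ) * (9 / 10) ^ N ≤ ∑ ζ ∈ 𝓢, (1 / 2 : ℝ) ^ ζ.card := by
          rw [← nsmul_eq_mul]
          exact Finset.card_nsmul_le_sum _ _ _ fun ζ hζ => hweight ζ (Finset.mem_filter.1 hζ).2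
      _ ≤ ∑ ζ : Finset J, (1 / 2 : ℝ) ^ ζ.card :=
          Finset.sum_le_sum_of_subset_of_nonneg (Finset.subset_univ _) fun _ _ _ => by positivity
      _ = (3 / 2) ^ N := htotal
  calc (𝓢.card : ℝ) ≤ (3 / 2) ^ N / (9 / 10) ^ N := (le_div_iff₀ (by positivity)).2 hmul
    _ = (5 / 3) ^ N := by rw [← div_pow]; norm_num

theorem card_le_mul_card_of_isCover {X S : Type*} [PseudoEMetricSpace X] [Fintype S] {F : S → X}
    {ε : NNReal} {C : Finset X} (hC : Metric.IsCover ε (Set.range F) (C : Set X)) {K : ℕ}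
    (hK : ∀ s₀, Nat.card {s // edist (F s₀) (F s) ≤ 2 * ε} ≤ K) :
    Fintype.card S ≤ K * C.card := by
  classical
  choose R hRC hR using fun s => hC (Set.mem_range_self s)
  refine Finset.card_le_mul_card_image_of_maps_to (fun s _ => hRC s) K fun c _ => ?_
  rcases (Finset.univ.filter fun s => R s = c).eq_empty_or_nonempty with h | ⟨s₀, hs₀⟩
  · simp only [h, Finset.card_empty, zero_le]
  · refine le_trans ?_ (hK s₀)
    rw [Nat.card_eq_fintype_card, Fintype.card_subtype]
    refine Finset.card_le_card fun s hs => ?_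
    simp only [Finset.mem_filter_univ] at hs hs₀ ⊢
    calc edist (F s₀) (F s) ≤ edist (F s₀) (R s₀) + edist (F s) (R s) := by
          rw [hs, hs₀]
          exact edist_triangle_right _ _ _
      _ ≤ ε + ε := add_le_add (hR s₀) (hR s)
      _ = 2 * ε := (two_mul _).symm

theorem ceil_pow_card_le_externalCoveringNumber {X J : Type*} [PseudoEMetricSpace X] [Fintype J]
    [DecidableEq J] {A : Set X} {ε : NNReal} {F : Finset J → X} (hF : ∀ η, F η ∈ A)
    (hsep : ∀ η η', edist (F η) (F η') ≤ 2 * ε → 8 * (symmDiff η η').card ≤ Fintype.card J) :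
    (⌈(6 / 5 : ℝ) ^ Fintype.card J⌉₊ : ℕ∞) ≤ Metric.externalCoveringNumber ε A := by
  refine le_iInf₂ fun C hC => ?_
  obtain hfin | hinf := C.finite_or_infinite
  swap
  · simp only [hinf.encard_eq, le_top]
  lift C to Finset X using hfin
  have hK (η₀ : Finset J) : Nat.card {η // edist (F η₀) (F η) ≤ 2 * ε}
      ≤ (Finset.univ.filter fun ζ : Finset J => 8 * ζ.card ≤ Fintype.card J).card := by
    rw [← Fintype.card_subtype, ← Nat.card_eq_fintype_card]
    exact Nat.card_le_card_of_injective
      (Subtype.map (symmDiff η₀) fun η hη => hsep η₀ η hη)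
      (Subtype.map_injective _ (symmDiff_right_injective η₀))
  have hcount := card_le_mul_card_of_isCover (hC.anti (Set.range_subset_iff.2 hF)) hK
  rw [Fintype.card_finset] at hcount
  have hreal : (5 / 3 : ℝ) ^ Fintype.card J * (6 / 5) ^ Fintype.card J
      ≤ (5 / 3) ^ Fintype.card J * C.card :=
    calc (5 / 3 : ℝ) ^ Fintype.card J * (6 / 5) ^ Fintype.card J = 2 ^ Fintype.card J := by
          rw [← mul_pow]
          norm_num
      _ ≤ (Finset.univ.filter fun ζ : Finset J => 8 * ζ.card ≤ Fintype.card J).card * C.card := by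
          exact_mod_cast hcount
      _ ≤ (5 / 3) ^ Fintype.card J * C.card := by
          gcongr
          exact card_filter_eight_mul_card_le J
  rw [Set.encard_coe_eq_coe_finsetCard, Nat.cast_le, Nat.ceil_le]
  exact le_of_mul_le_mul_left hreal (by positivity)

end Packing

section Paraboloid

variable {E J : Type*} [NormedAddCommGroup E]

/-- The paraboloid `‖t‖²` with its tangent planes at the points `c j`, `j ∈ η`, raised by `δ²` and
cut in. -/
noncomputable def raisedParaboloid (c : J → E) (δ : ℝ) (η : Finset J) (t : E) : ℝ :=
  η.fold max (‖t‖ ^ 2) fun j => ‖t‖ ^ 2 + δ ^ 2 - ‖t - c j‖ ^ 2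

variable {c : J → E} {δ : ℝ} {η η' : Finset J} {t : E}

theorem sq_norm_le_raisedParaboloid : ‖t‖ ^ 2 ≤ raisedParaboloid c δ η t :=
  Finset.le_fold_max _ |>.2 (Or.inl le_rfl)

theorem raisedParaboloid_le : raisedParaboloid c δ η t ≤ ‖t‖ ^ 2 + δ ^ 2 :=
  Finset.fold_max_le _ |>.2 ⟨le_add_of_nonneg_right (sq_nonneg δ),
    fun _ _ => sub_le_self _ (sq_nonneg _)⟩

theorem convexOn_raisedParaboloid [InnerProductSpace ℝ E] (c : J → E) (δ : ℝ) (η : Finset J) :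
    ConvexOn ℝ Set.univ (raisedParaboloid c δ η) := by
  induction η using Finset.cons_induction with
  | empty => exact convexOn_univ_norm.pow (fun _ _ => norm_nonneg _) 2
  | cons j η hj ih =>
    have htangent (t : E) :
        ‖t‖ ^ 2 + δ ^ 2 - ‖t - c j‖ ^ 2 = innerₗ E ((2 : ℝ) • c j) t + (δ ^ 2 - ‖c j‖ ^ 2) := by
      rw [norm_sub_sq_real, innerₗ_apply_apply, real_inner_smul_left, real_inner_comm]
      ring
    refine ConvexOn.congr (((innerₗ E ((2 : ℝ) • c j)).convexOn convex_univ).add_const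
      (δ ^ 2 - ‖c j‖ ^ 2) |>.sup ih) fun t _ => ?_
    rw [raisedParaboloid, Finset.fold_cons, htangent]
    rfl

theorem le_abs_raisedParaboloid_sub [DecidableEq J] {j : J} (hj : j ∈ symmDiff η η')
    (hnear : ‖t - c j‖ ^ 2 ≤ δ ^ 2 / 4) (hfar : ∀ j', j' ≠ j → δ ^ 2 ≤ ‖t - c j'‖ ^ 2) :
    3 / 4 * δ ^ 2 ≤ |raisedParaboloid c δ η t - raisedParaboloid c δ η' t| := by
  have hdiff {ξ ξ' : Finset J} (h : j ∈ ξ) (h' : j ∉ ξ') :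
      3 / 4 * δ ^ 2 ≤ raisedParaboloid c δ ξ t - raisedParaboloid c δ ξ' t := by
    have hle : ‖t‖ ^ 2 + δ ^ 2 - ‖t - c j‖ ^ 2 ≤ raisedParaboloid c δ ξ t :=
      Finset.le_fold_max _ |>.2 (Or.inr ⟨j, h, le_rfl⟩)
    have hge : raisedParaboloid c δ ξ' t ≤ ‖t‖ ^ 2 :=
      Finset.fold_max_le _ |>.2 ⟨le_rfl, fun j' hj' => by
        linarith [hfar j' fun e => h' (e ▸ hj')]⟩
    linarith
  rcases Finset.mem_symmDiff.1 hj with ⟨h, h'⟩ | ⟨h, h'⟩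
  · exact (hdiff h h').trans (le_abs_self _)
  · rw [abs_sub_comm]
    exact (hdiff h h').trans (le_abs_self _)

end Paraboloid

section Cells

variable {d n : ℕ} {j j' : Fin d → Fin n} {x : Fin d → ℝ}

/-- The centre of the subcube with index `j` in the subdivision of the unit cube into `n ^ d` equal
cubes. -/
noncomputable def cellCenter (j : Fin d → Fin n) (i : Fin d) : ℝ := (2 * (j i : ℕ) + 1) / (2 * n)

/-- The closed cube concentric with the subcube with index `j`, smaller by the factor `2 * d`. -/
noncomputable def cell (j : Fin d → Fin n) : Set (Fin d → ℝ) :=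
  Metric.closedBall (cellCenter j) (1 / (2 * n) / (2 * d))

theorem le_cellCenter (j : Fin d → Fin n) (i : Fin d) : 1 / (2 * n) ≤ cellCenter j i := by
  unfold cellCenter
  gcongr
  linarith [Nat.cast_nonneg (α := ℝ) (j i : ℕ)]

theorem cellCenter_le (j : Fin d → Fin n) (i : Fin d) : cellCenter j i ≤ 1 - 1 / (2 * n) := by
  have hj : ((j i : ℕ) : ℝ) + 1 ≤ n := by exact_mod_cast (j i).2
  have hn : (0 : ℝ) < n := by linarith [Nat.cast_nonneg (α := ℝ) (j i : ℕ)]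
  unfold cellCenter
  rw [le_sub_iff_add_le, ← add_div, div_le_one (by positivity)]
  linarith

theorem two_mul_le_dist_cellCenter (h : j' ≠ j) :
    2 * (1 / (2 * n)) ≤ dist (cellCenter j) (cellCenter j') := by
  obtain ⟨i, hi⟩ := Function.ne_iff.1 h
  have hne : ((j i : ℕ) : ℤ) - (j' i : ℕ) ≠ 0 := fun e => hi (Fin.ext (by omega))
  have hone : (1 : ℝ) ≤ |((j i : ℕ) : ℝ) - (j' i : ℕ)| := by exact_mod_cast Int.one_le_abs hne
  calc (2 * (1 / (2 * n)) : ℝ) ≤ 2 * (1 / (2 * n)) * |((j i : ℕ) : ℝ) - (j' i : ℕ)| :=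
        le_mul_of_one_le_right (by positivity) hone
    _ = |2 * (1 / (2 * n)) * (((j i : ℕ) : ℝ) - (j' i : ℕ))| := by
        rw [abs_mul, abs_of_nonneg (by positivity : (0 : ℝ) ≤ 2 * (1 / (2 * n)))]
    _ = dist (cellCenter j i) (cellCenter j' i) := by
        rw [Real.dist_eq, cellCenter, cellCenter]
        ring_nf
    _ ≤ dist (cellCenter j) (cellCenter j') := dist_le_pi_dist _ _ i

theorem cell_radius_le (hd : 1 ≤ d) (n : ℕ) : (1 / (2 * n) / (2 * d) : ℝ) ≤ 1 / (2 * n) / 2 := by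
  have hd' : (1 : ℝ) ≤ d := by exact_mod_cast hd
  gcongr
  linarith

theorem cell_subset_Icc (hd : 1 ≤ d) (j : Fin d → Fin n) : cell j ⊆ Set.Icc 0 1 := fun x hx => by
  have hr := cell_radius_le hd n
  have hδ : (0 : ℝ) ≤ 1 / (2 * n) := by positivity
  have hxi (i) := abs_le.1 ((Real.dist_eq _ _).symm.trans_le ((dist_le_pi_dist x _ i).trans hx))
  exact ⟨fun i => by simp only [Pi.zero_apply]; linarith [hxi i, le_cellCenter j i],
    fun i => by simp only [Pi.one_apply]; linarith [hxi i, cellCenter_le j i]⟩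

theorem pairwise_disjoint_cell (hd : 1 ≤ d) (hn : n ≠ 0) :
    Pairwise (Function.onFun Disjoint (cell : (Fin d → Fin n) → Set (Fin d → ℝ))) := by
  intro j j' h
  have hδ : (0 : ℝ) < 1 / (2 * n) := by positivity
  exact Metric.closedBall_disjoint_closedBall <| by
    linarith [cell_radius_le hd n, two_mul_le_dist_cellCenter h.symm]

theorem volume_cell (hd : d ≠ 0) (j : Fin d → Fin n) :
    volume (cell j) = ENNReal.ofReal ((2 * d * n : ℝ)⁻¹ ^ d) := by
  have hd' : (d : ℝ) ≠ 0 := by exact_mod_cast hd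
  rw [cell, Real.volume_pi_closedBall _ (by positivity), Fintype.card_fin]
  congr 2
  field_simp

theorem sq_norm_sub_cellCenter_le (hd : 1 ≤ d) (hx : x ∈ cell j) :
    ‖WithLp.toLp 2 x - WithLp.toLp 2 (cellCenter j)‖ ^ 2 ≤ (1 / (2 * n) : ℝ) ^ 2 / 4 := by
  have hd' : (1 : ℝ) ≤ d := by exact_mod_cast hd
  have hxi (i) : |x i - cellCenter j i| ≤ 1 / (2 * n) / (2 * d) :=
    (Real.dist_eq _ _).symm.trans_le ((dist_le_pi_dist x _ i).trans hx)
  rw [EuclideanSpace.real_norm_sq_eq]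
  calc ∑ i, (x i - cellCenter j i) ^ 2 ≤ ∑ _i : Fin d, (1 / (2 * n) / (2 * d) : ℝ) ^ 2 :=
        Finset.sum_le_sum fun i _ => sq_le_sq.2 ((hxi i).trans (le_abs_self _))
    _ = (1 / (2 * n) : ℝ) ^ 2 / 4 * (1 / d) := by
        rw [Finset.sum_const, Finset.card_univ, Fintype.card_fin, nsmul_eq_mul]
        field_simp
        norm_num
    _ ≤ (1 / (2 * n) : ℝ) ^ 2 / 4 :=
        mul_le_of_le_one_right (by positivity) ((div_le_one (by positivity)).2 hd')

theorem le_sq_norm_sub_cellCenter (hd : 1 ≤ d) (hx : x ∈ cell j) (h : j' ≠ j) :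
    (1 / (2 * n) : ℝ) ^ 2 ≤ ‖WithLp.toLp 2 x - WithLp.toLp 2 (cellCenter j')‖ ^ 2 := by
  have hδ : (0 : ℝ) ≤ 1 / (2 * n) := by positivity
  have hdist : dist x (cellCenter j')
      ≤ ‖WithLp.toLp 2 x - WithLp.toLp 2 (cellCenter j')‖ :=
    (dist_pi_le_iff (norm_nonneg _)).2 fun i =>
      PiLp.norm_apply_le (WithLp.toLp 2 x - WithLp.toLp 2 (cellCenter j')) i
  gcongr
  linarith [cell_radius_le hd n, two_mul_le_dist_cellCenter h, Metric.mem_closedBall'.1 hx,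
    dist_triangle (cellCenter j) x (cellCenter j')]

end Cells

section LowerBound

theorem card_mul_le_eLpNorm_one {α J : Type*} [MeasurableSpace α] {μ : Measure α} {f : α → ℝ}
    (D : Finset J) {s : J → Set α} (hs : ∀ j, MeasurableSet (s j))
    (hdisj : Pairwise (Function.onFun Disjoint s)) {v m : ℝ≥0∞} (hv : ∀ j, v ≤ μ (s j))
    (hf : ∀ j ∈ D, ∀ x ∈ s j, m ≤ ‖f x‖ₑ) : D.card * (m * v) ≤ eLpNorm f 1 μ :=
  calc D.card * (m * v) = ∑ _j ∈ D, m * v := by rw [Finset.sum_const, nsmul_eq_mul]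
    _ ≤ ∑ j ∈ D, ∫⁻ x in s j, ‖f x‖ₑ ∂μ := by
        refine Finset.sum_le_sum fun j hj => ?_
        calc m * v ≤ m * μ (s j) := by gcongr; exact hv j
          _ = ∫⁻ _ in s j, m ∂μ := (setLIntegral_const _ _).symm
          _ ≤ ∫⁻ x in s j, ‖f x‖ₑ ∂μ := setLIntegral_mono' (hs j) (hf j hj)
    _ = ∫⁻ x in ⋃ j ∈ D, s j, ‖f x‖ₑ ∂μ :=
        (lintegral_biUnion_finset (hdisj.set_pairwise _) (fun j _ => hs j) _).symm
    _ ≤ eLpNorm f 1 μ := by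
        rw [eLpNorm_one_eq_lintegral_enorm]
        exact setLIntegral_le_lintegral _ _

variable {d n : ℕ} {p q : ℝ≥0∞} {B : ℝ} {f : (Fin d → ℝ) → ℝ}

theorem volume_unitCube (d : ℕ) : volume (Set.Icc (0 : Fin d → ℝ) 1) = 1 := by
  simp [Real.volume_Icc_pi]

theorem mem_convexClass_unitCube_of_abs_le (hp : p ≠ 0) (hf : ConvexOn ℝ (Set.Icc 0 1) f)
    (hfB : ∀ x ∈ Set.Icc 0 1, |f x| ≤ B) : f ∈ convexClass p 0 1 B := by
  rcases eq_or_ne p ∞ with rfl | hpt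
  · exact mem_convexClass_top.2 ⟨hf, hfB⟩
  · refine (mem_convexClass_iff hp hpt).2 ⟨hf, ?_⟩
    have hbound : ∀ x ∈ Set.Icc (0 : Fin d → ℝ) 1, ‖f x‖ ≤ B := hfB
    simpa [volume_unitCube] using eLpNorm_le_of_ae_bound (p := p)
      (ae_restrict_of_forall_mem (μ := volume) measurableSet_Icc hbound)

/-- A convex function on the unit cube, bounded by `1`, which is a multiple of the paraboloid
except for flat facets around the centres of the subcubes with indices in `η`. -/
noncomputable def facetedParaboloid (η : Finset (Fin d → Fin n)) (x : Fin d → ℝ) : ℝ :=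
  (d + 1 : ℝ)⁻¹ * raisedParaboloid (fun j => WithLp.toLp 2 (cellCenter j)) (1 / (2 * n)) η
    (WithLp.toLp 2 x : EuclideanSpace ℝ (Fin d))

theorem convexOn_facetedParaboloid (η : Finset (Fin d → Fin n)) :
    ConvexOn ℝ (Set.Icc 0 1) (facetedParaboloid η) :=
  (((convexOn_raisedParaboloid _ _ η).comp_linearMap
    (WithLp.linearEquiv 2 ℝ (Fin d → ℝ)).symm.toLinearMap).smul (by positivity)).subset
      (Set.subset_univ _) (convex_Icc 0 1)

theorem abs_facetedParaboloid_le_one (hn : n ≠ 0) (η : Finset (Fin d → Fin n)) {x : Fin d → ℝ}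
    (hx : x ∈ Set.Icc 0 1) : |facetedParaboloid η x| ≤ 1 := by
  have hn' : (1 : ℝ) ≤ n := by exact_mod_cast Nat.one_le_iff_ne_zero.2 hn
  set t : EuclideanSpace ℝ (Fin d) := WithLp.toLp 2 x
  set F := raisedParaboloid (fun j => WithLp.toLp 2 (cellCenter j)) (1 / (2 * n)) η t
  have hF0 : 0 ≤ F := (sq_nonneg ‖t‖).trans sq_norm_le_raisedParaboloid
  have hF : F ≤ ‖t‖ ^ 2 + (1 / (2 * n)) ^ 2 := raisedParaboloid_le
  have ht : ‖t‖ ^ 2 ≤ d := by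
    rw [EuclideanSpace.real_norm_sq_eq]
    exact (Finset.sum_le_sum fun i _ => pow_le_one₀ (hx.1 i) (hx.2 i)).trans_eq (by simp)
  have hδ : (1 / (2 * n) : ℝ) ^ 2 ≤ 1 :=
    pow_le_one₀ (by positivity) ((div_le_one (by positivity)).2 (by linarith))
  rw [facetedParaboloid, abs_of_nonneg (by positivity), inv_mul_le_one₀ (by positivity)]
  linarith

theorem facetedParaboloid_mem_convexClass (hp : p ≠ 0) (hn : n ≠ 0) (η : Finset (Fin d → Fin n)) :
    facetedParaboloid η ∈ convexClass p 0 1 1 :=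
  mem_convexClass_unitCube_of_abs_le hp (convexOn_facetedParaboloid η) fun _ =>
    abs_facetedParaboloid_le_one hn η

theorem le_abs_facetedParaboloid_sub (hd : 1 ≤ d) {η η' : Finset (Fin d → Fin n)}
    {j : Fin d → Fin n} (hj : j ∈ symmDiff η η') {x : Fin d → ℝ} (hx : x ∈ cell j) :
    (d + 1 : ℝ)⁻¹ * (3 / 4 * (1 / (2 * n)) ^ 2)
      ≤ |facetedParaboloid η x - facetedParaboloid η' x| := by
  rw [facetedParaboloid, facetedParaboloid, ← mul_sub, abs_mul, abs_of_nonneg (by positivity)]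
  gcongr
  exact le_abs_raisedParaboloid_sub hj (sq_norm_sub_cellCenter_le hd hx) fun _ =>
    le_sq_norm_sub_cellCenter hd hx

theorem card_symmDiff_mul_le_eLpNorm (hd : 1 ≤ d) (hn : n ≠ 0) (hq : 1 ≤ q)
    (η η' : Finset (Fin d → Fin n)) :
    ENNReal.ofReal ((symmDiff η η').card *
        ((d + 1 : ℝ)⁻¹ * (3 / 4 * (1 / (2 * n)) ^ 2) * (2 * d * n : ℝ)⁻¹ ^ d))
      ≤ eLpNorm (fun x => facetedParaboloid η x - facetedParaboloid η' x) q
        (volume.restrict (Set.Icc 0 1)) := by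
  have : IsProbabilityMeasure (volume.restrict (Set.Icc (0 : Fin d → ℝ) 1)) :=
    ⟨by rw [Measure.restrict_apply_univ, volume_unitCube]⟩
  have hmeas (η : Finset (Fin d → Fin n)) :
      AEStronglyMeasurable (facetedParaboloid η) (volume.restrict (Set.Icc 0 1)) :=
    (memLp_of_mem_convexClass ENNReal.top_ne_zero le_rfl
      (facetedParaboloid_mem_convexClass ENNReal.top_ne_zero hn η)).1
  refine le_trans ?_ (eLpNorm_le_eLpNorm_of_exponent_le hq ((hmeas η).sub (hmeas η')))
  rw [ENNReal.ofReal_mul (by positivity), ENNReal.ofReal_mul (by positivity),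
    ENNReal.ofReal_natCast]
  refine card_mul_le_eLpNorm_one _ (s := cell) (fun _ => measurableSet_closedBall)
    (pairwise_disjoint_cell hd hn) (fun j => ?_) fun j hj x hx => ?_
  · rw [Measure.restrict_eq_self _ (cell_subset_Icc hd j), volume_cell (by omega)]
  · rw [Real.enorm_eq_ofReal_abs]
    exact ENNReal.ofReal_le_ofReal (le_abs_facetedParaboloid_sub hd hj hx)

theorem eight_mul_le_pow (hd : d ≠ 0) (hn : n ≠ 0) {k : ℕ} {ε : ℝ}
    (hk : k * ((d + 1 : ℝ)⁻¹ * (3 / 4 * (1 / (2 * n)) ^ 2) * (2 * d * n : ℝ)⁻¹ ^ d) ≤ 2 * ε)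
    (hε : ε * n ^ 2 ≤ 3 / (256 * (d + 1) * (2 * d) ^ d)) : 8 * k ≤ n ^ d := by
  have : (0 : ℝ) < d := by exact_mod_cast Nat.pos_of_ne_zero hd
  have : (0 : ℝ) < n := by exact_mod_cast Nat.pos_of_ne_zero hn
  set D : ℝ := (d + 1) * (2 * d) ^ d
  have hD : 0 < D := by positivity
  have hscaled : (k : ℝ) * (3 / (16 * D)) ≤ n ^ d * (3 / (128 * D)) :=
    calc (k : ℝ) * (3 / (16 * D))
        = k * ((d + 1 : ℝ)⁻¹ * (3 / 4 * (1 / (2 * n)) ^ 2) * (2 * d * n : ℝ)⁻¹ ^ d)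
            * (n ^ 2 * n ^ d) := by
          simp only [D, inv_pow, mul_pow]
          field_simp
          ring
      _ ≤ 2 * ε * (n ^ 2 * n ^ d) := by gcongr
      _ = n ^ d * (2 * (ε * n ^ 2)) := by ring
      _ ≤ n ^ d * (2 * (3 / (256 * (d + 1) * (2 * d) ^ d))) := by gcongr
      _ = n ^ d * (3 / (128 * D)) := by
          simp only [D]
          field_simp
          norm_num
  have hcancel : (8 * k : ℝ) * (3 / (128 * D)) ≤ n ^ d * (3 / (128 * D)) := by
    refine le_of_eq_of_le ?_ hscaled
    field_simp
    ring
  exact_mod_cast le_of_mul_le_mul_right hcancel (by positivity)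

theorem log_mul_le_convexEntropy_unitCube (hd : 1 ≤ d) [Fact (1 ≤ q)] (hqp : q ≤ p) (hn : n ≠ 0)
    {ε : ℝ} (hε : 0 ≤ ε) (hεn : ε * n ^ 2 ≤ 3 / (256 * (d + 1) * (2 * d) ^ d)) :
    ((Real.log (6 / 5) * n ^ d : ℝ) : EReal) ≤ convexEntropy p q (0 : Fin d → ℝ) 1 1 ε := by
  have hp : p ≠ 0 := ((one_pos.trans_le Fact.out).trans_le hqp).ne'
  let F (η : Finset (Fin d → Fin n)) : LqFun q (volume.restrict (Set.Icc (0 : Fin d → ℝ) 1)) :=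
    ⟨facetedParaboloid η,
      memLp_of_mem_convexClass hp hqp (facetedParaboloid_mem_convexClass hp hn η)⟩
  let A : Set (LqFun q (volume.restrict (Set.Icc (0 : Fin d → ℝ) 1))) :=
    {f | f.1 ∈ convexClass p 0 1 1}
  have hF (η) : F η ∈ A := facetedParaboloid_mem_convexClass hp hn η
  have hsep (η η') (h : edist (F η) (F η') ≤ 2 * ε.toNNReal) :
      8 * (symmDiff η η').card ≤ Fintype.card (Fin d → Fin n) := by
    have hle := (card_symmDiff_mul_le_eLpNorm hd hn Fact.out η η').trans h
    rw [← ENNReal.ofReal, ← ENNReal.ofReal_ofNat 2, ← ENNReal.ofReal_mul zero_le_two,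
      ENNReal.ofReal_le_ofReal_iff (by positivity)] at hle
    rw [Fintype.card_fun, Fintype.card_fin, Fintype.card_fin]
    exact eight_mul_le_pow (by omega) hn hle hεn
  have hcover : ENNReal.ofReal ((6 / 5) ^ n ^ d)
      ≤ (Metric.externalCoveringNumber ε.toNNReal A : ℕ∞) := by
    have hceil := ENat.toENNReal_le.2 (ceil_pow_card_le_externalCoveringNumber hF hsep)
    rw [Fintype.card_fun, Fintype.card_fin, Fintype.card_fin, ENat.toENNReal_coe] at hceil
    exact (ENNReal.ofReal_le_natCast.2 (Nat.le_ceil _)).trans hceil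
  refine le_of_eq_of_le ?_ (ENNReal.log_monotone hcover)
  rw [ENNReal.log_ofReal_of_pos (by positivity), Real.log_pow, Nat.cast_pow, mul_comm]

theorem exists_le_convexEntropy_unitCube (hd : 1 ≤ d) [Fact (1 ≤ q)] (hqp : q ≤ p) :
    ∃ c ε₀ : ℝ, 0 < c ∧ 0 < ε₀ ∧ ∀ ε : ℝ, 0 < ε → ε ≤ ε₀ →
      ((c * ε ^ (-(d : ℝ) / 2) : ℝ) : EReal) ≤ convexEntropy p q (0 : Fin d → ℝ) 1 1 ε := by
  have : (0 : ℝ) < d := by exact_mod_cast hd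
  set θ : ℝ := 3 / (256 * (d + 1) * (2 * d) ^ d)
  have hθ : 0 < θ := by positivity
  have : 0 < Real.log (6 / 5) := Real.log_pos (by norm_num)
  refine ⟨Real.log (6 / 5) * (θ / 4) ^ ((d : ℝ) / 2), θ, by positivity, hθ, fun ε hε hεθ => ?_⟩
  set r := √(θ / ε)
  have hr : 1 ≤ r := Real.one_le_sqrt.2 ((one_le_div hε).2 hεθ)
  have hn : 1 ≤ ⌊r⌋₊ := Nat.one_le_floor_iff _ |>.2 hr
  have hεn : ε * ⌊r⌋₊ ^ 2 ≤ θ :=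
    calc ε * ⌊r⌋₊ ^ 2 ≤ ε * r ^ 2 := by
          gcongr
          exact Nat.floor_le (by positivity)
      _ = θ := by rw [Real.sq_sqrt (by positivity), mul_div_cancel₀ _ hε.ne']
  have hhalf : r / 2 ≤ ⌊r⌋₊ := by
    have : (1 : ℝ) ≤ ⌊r⌋₊ := by exact_mod_cast hn
    linarith [Nat.lt_floor_add_one r]
  have hpow : (r / 2) ^ d = (θ / 4) ^ ((d : ℝ) / 2) * ε ^ (-(d : ℝ) / 2) := by
    rw [neg_div, Real.rpow_neg hε.le, ← div_eq_mul_inv, ← Real.div_rpow (by positivity) hε.le,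
      Real.rpow_div_two_eq_sqrt _ (by positivity), Real.rpow_natCast, div_right_comm,
      Real.sqrt_div' _ (by norm_num)]
    norm_num [r]
  refine le_trans (EReal.coe_le_coe_iff.2 ?_)
    (log_mul_le_convexEntropy_unitCube hd hqp (Nat.one_le_iff_ne_zero.1 hn)
      hε.le hεn)
  rw [mul_assoc, ← hpow]
  gcongr

end LowerBound

theorem theorem2 (d : ℕ) (hd : 1 ≤ d) (p q : ℝ≥0∞) [Fact (1 ≤ q)] (hqp : q < p) :
    ∃ c₁ c₂ ε₀ : ℝ, 0 < c₁ ∧ 0 < c₂ ∧ 0 < ε₀ ∧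
      ∀ (a b : Fin d → ℝ) (B : ℝ), (∀ i, a i < b i) → 0 < B →
        (∀ ε : ℝ, 0 < ε →
          convexEntropy p q a b B ε
            ≤ ((c₁ * (ε / entropyScale p q a b B) ^ (-(d : ℝ) / 2) : ℝ) : EReal)) ∧
        (∀ ε : ℝ, 0 < ε → ε ≤ ε₀ * entropyScale p q a b B →
          ((c₂ * (ε / entropyScale p q a b B) ^ (-(d : ℝ) / 2) : ℝ) : EReal)
            ≤ convexEntropy p q a b B ε) := by
  obtain ⟨c₁, hc₁, hupper⟩ := exists_convexEntropy_unitCube_le hd hqp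
  obtain ⟨c₂, ε₀, hc₂, hε₀, hlower⟩ := exists_le_convexEntropy_unitCube hd hqp.le
  refine ⟨c₁, c₂, ε₀, hc₁, hc₂, hε₀, fun a b B hab hB => ?_⟩
  have hS : 0 < entropyScale p q a b B := entropyScale_pos hab hB
  simp only [convexEntropy_eq_unitCube hqp.ne_bot hab hB]
  exact ⟨fun ε hε => hupper _ (div_pos hε hS),
    fun ε hε hεS => hlower _ (div_pos hε hS) ((div_le_iff₀ hS).2 hεS)⟩
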